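/- **Setting.** Let $W^{2\times2}$ be the algebra of $2\times 2$ matrix functions $A(t)=\sum_{k\in\mathbb Z}A_kt^k$ on the unit circle $\mathbb T$ with $\|A\|_W=\sum_k\|A_k\|_1<\infty$, where $\|\cdot\|_1$ is the maximum column sum norm, and let $W_+^{2\times2}$ (respectively $W_-^{2\times2}$) be the subalgebra of those $A$ with $A_k=0$ for $k<0$ (respectively for $k>0$). A right Wiener–Hopf factorisation of $A$ with partial indices $\rho_1\le\rho_2$ ($\rho_1,\rho_2\in\mathbb Z$) is a representation $A(t)=A_-(t)d_r(t)A_+(t)$ on $\mathbb T$ with $d_r(t)=\operatorname{diag}[t^{\rho_1},t^{\rho_2}]$, where $A_\pm$ is an invertible element of $W_\pm^{2\times2}$. It is stable if $\rho_2-\rho_1\le1$. Let $P=I_2$ or $P=J_2=\begin{pmatrix}0&1\\1&0\end{pmatrix}$, and write $A_-(t)=A_0+A_1t^{-1}+\cdots$, so that $A_0=A_-(\infty)$. A stable factorisation is $P$-normalised if: in the case $\rho_1=\rho_2$, $A_0=I_2$; in the case $\rho_2=\rho_1+1$, $P^{-1}A_0$ is lower triangular with unit diagonal and $(P^{-1}A_1)_{12}=0$.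 Let $0\le r_1<1<r_2\le\infty$ and $\theta\in\mathbb Z$. Let $\alpha_+$ be analytic in $|t|<r_2$ and let $\beta_-$ be analytic in $|t|>r_1$ with $\beta_-(t)\to0$ as $t\to\infty$. Write $\alpha_+(t)=\sum_{k\ge0}\alpha_kt^k$, $\beta_-(t)=\sum_{k\le-1}\beta_kt^k$, $\alpha_+^{(N)}(t)=\sum_{k=0}^N\alpha_kt^k$, $\beta_-^{(N)}(t)=\sum_{k=-N}^{-1}\beta_kt^k$, and $$a(t)=\begin{pmatrix}1&\beta_-(t)\\ \alpha_+(t)&t^\theta+\alpha_+(t)\beta_-(t)\end{pmatrix},\qquad a_N(t)=\begin{pmatrix}1&\beta_-^{(N)}(t)\\ \alpha_+^{(N)}(t)&t^\theta+\alpha_+^{(N)}(t)\beta_-^{(N)}(t)\end{pmatrix}.$$ A pair $(\zeta_1,\zeta_2)$ is admissible if $r_1<\zeta_1<1<\zeta_2<r_2$; in addition $\zeta_1=r_1$ is allowed if $r_1>0$ and $\beta_-$ extends continuously to $|t|=r_1$, and $\zeta_2=r_2$ is allowed if $r_2<\infty$ and $\alpha_+$ extends continuously to $|t|=r_2$. With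 $M_-(\zeta_1)=\max_{|t|=\zeta_1}|\beta_-(t)|$ and $M_+(\zeta_2)=\max_{|t|=\zeta_2}|\alpha_+(t)|$, put $$\delta_N(\zeta_1,\zeta_2)=\Bigl(1+\frac{\zeta_2M_+(\zeta_2)}{\zeta_2-1}\Bigr)\frac{\zeta_1^{N+1}M_-(\zeta_1)}{1-\zeta_1}+\Bigl(1+\frac{\zeta_1M_-(\zeta_1)}{1-\zeta_1}\Bigr)\frac{M_+(\zeta_2)}{\zeta_2^N(\zeta_2-1)},$$ and let $\sigma=\|d_r\|_W$, that is, $\sigma=1$ if $\theta$ is even and $\sigma=2$ if $\theta$ is odd. **Theorem.** Suppose that $a(t)$ admits a stable $P$-normalised factorisation $a=a_-d_ra_+$ with partial indices $\rho_1\le\rho_2$. Then there is $N_0$ such that for all $N>N_0$ the Laurent matrix polynomial $a_N$ admits a stable $P$-normalised factorisation $a_N=a_-^{(N)}d_ra_+^{(N)}$ with the same $P$ and the same partial indices $\rho_1,\rho_2$. Moreover, for every compact set $K$ of admissible pairs (in particular for every single admissible pair) there is $N_K\ge N_0$ such that for all $N>N_K$, all $(\zeta_1,\zeta_2)\in K$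 and every stable $P$-normalised factorisation $a_N=a_-^{(N)}d_ra_+^{(N)}$ with these partial indices, $$q_N(\zeta_1,\zeta_2)=\sigma\,\delta_N(\zeta_1,\zeta_2)\,\bigl\|(a_+^{(N)})^{-1}\bigr\|_W\,\bigl\|(a_-^{(N)})^{-1}\bigr\|_W<1 .$$ -/

import Mathlib

open Filter Topology
open scoped ENNReal

noncomputable section

namespace WienerHopf

/-- Functions of a complex variable with values in the complex `2 × 2` matrices. Only the values on
the unit circle matter in the definitions below. -/
abbrev MatFun : Type := ℂ → Matrix (Fin 2) (Fin 2) ℂ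

/-- The `k`-th Fourier coefficient of `f` on the unit circle, that is, the mean value of
`t ^ (-k) * f t` over `|t| = 1`. -/
def fourierCoef (f : ℂ → ℂ) (k : ℤ) : ℂ :=
  Real.circleAverage (fun t => t ^ (-k) * f t) 0 1

/-- The `k`-th matrix Fourier coefficient, taken entrywise. -/
def matCoef (A : MatFun) (k : ℤ) : Matrix (Fin 2) (Fin 2) ℂ :=
  Matrix.of fun i j => fourierCoef (fun t => A t i j) k

/-- The maximum column sum norm of a `2 × 2` matrix. -/
def colSumNorm (B : Matrix (Fin 2) (Fin 2) ℂ) : ℝ :=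
  max (‖B 0 0‖ + ‖B 1 0‖) (‖B 0 1‖ + ‖B 1 1‖)

/-- The norm of the matrix Wiener algebra: the sum of the norms of the Fourier coefficients. -/
def wienerNorm (A : MatFun) : ℝ :=
  ∑' k : ℤ, colSumNorm (matCoef A k)

/-- Membership in the matrix Wiener algebra: on the unit circle `A` is the sum of its absolutely
convergent Fourier series. -/
def MemWiener (A : MatFun) : Prop :=
  Summable (fun k : ℤ => colSumNorm (matCoef A k)) ∧
    ∀ t : ℂ, ‖t‖ = 1 → HasSum (fun k : ℤ => t ^ k • matCoef A k) (A t)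

/-- The subalgebra of the Fourier series with non-negative powers only. -/
def MemWienerPlus (A : MatFun) : Prop :=
  MemWiener A ∧ ∀ k : ℤ, k < 0 → matCoef A k = 0

/-- The subalgebra of the Fourier series with non-positive powers only. -/
def MemWienerMinus (A : MatFun) : Prop :=
  MemWiener A ∧ ∀ k : ℤ, 0 < k → matCoef A k = 0

/-- The pointwise inverse of a matrix function. -/
def matInv (A : MatFun) : MatFun := fun t => (A t)⁻¹

/-- The invertible elements of the plus subalgebra. -/
def IsUnitWienerPlus (A : MatFun) : Prop :=
  MemWienerPlus A ∧ (∀ t : ℂ, ‖t‖ = 1 → IsUnit (A t)) ∧ MemWienerPlus (matInv A)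

/-- The invertible elements of the minus subalgebra. -/
def IsUnitWienerMinus (A : MatFun) : Prop :=
  MemWienerMinus A ∧ (∀ t : ℂ, ‖t‖ = 1 → IsUnit (A t)) ∧ MemWienerMinus (matInv A)

/-- The diagonal factor `diag (t ^ ρ₁, t ^ ρ₂)`. -/
def diagFactor (ρ₁ ρ₂ : ℤ) : MatFun := fun t => !![t ^ ρ₁, 0; 0, t ^ ρ₂]

/-- `A = Am * diag (t ^ ρ₁, t ^ ρ₂) * Ap` on the unit circle is a right Wiener-Hopf factorisation,
with right partial indices `ρ₁ ≤ ρ₂`. -/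
structure IsRightFactorisation (A : MatFun) (ρ₁ ρ₂ : ℤ) (Am Ap : MatFun) : Prop where
  minus : IsUnitWienerMinus Am
  plus : IsUnitWienerPlus Ap
  le : ρ₁ ≤ ρ₂
  eq : ∀ t : ℂ, ‖t‖ = 1 → A t = Am t * diagFactor ρ₁ ρ₂ t * Ap t

/-- The permutation matrix of order two other than the identity. -/
def J₂ : Matrix (Fin 2) (Fin 2) ℂ := !![0, 1; 1, 0]

/-- `P`-normalisation of the minus factor `Am` of a factorisation with stable partial indices
`ρ₁ ≤ ρ₂ ≤ ρ₁ + 1`. Note that `matCoef Am 0` is the value of `Am` at infinity.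
If `ρ₁ = ρ₂`, this value has to be the identity matrix. If `ρ₂ = ρ₁ + 1`, it has to be `P * L` with
`L` unit lower triangular, and the coefficient of `t⁻¹` in the entry `(1, 2)` of `P⁻¹ * Am` has
to vanish. -/
def IsPNormalised (P : Matrix (Fin 2) (Fin 2) ℂ) (ρ₁ ρ₂ : ℤ) (Am : MatFun) : Prop :=
  (ρ₁ = ρ₂ → matCoef Am 0 = 1) ∧
  (ρ₂ = ρ₁ + 1 →
    (∃ l : ℂ, matCoef Am 0 = P * !![1, 0; l, 1]) ∧ (P⁻¹ * matCoef Am (-1)) 0 1 = 0)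

/-- A stable `P`-normalised right factorisation. -/
structure IsStablePFactorisation (P : Matrix (Fin 2) (Fin 2) ℂ) (A : MatFun) (ρ₁ ρ₂ : ℤ)
    (Am Ap : MatFun) : Prop where
  fact : IsRightFactorisation A ρ₁ ρ₂ Am Ap
  stable : ρ₂ - ρ₁ ≤ 1
  normalised : IsPNormalised P ρ₁ ρ₂ Am

/-- The matrix function in reduced form. -/
def reducedForm (θ : ℤ) (α β : ℂ → ℂ) : MatFun :=
  fun t => !![1, β t; α t, t ^ θ + α t * β t]

/-- The truncation `∑ k = 0, …, N` of the Fourier series of `α`. -/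
def truncPlus (α : ℂ → ℂ) (N : ℕ) : ℂ → ℂ :=
  fun t => ∑ k ∈ Finset.Icc (0 : ℤ) N, fourierCoef α k * t ^ k

/-- The truncation `∑ k = -N, …, -1` of the Fourier series of `β`. -/
def truncMinus (β : ℂ → ℂ) (N : ℕ) : ℂ → ℂ :=
  fun t => ∑ k ∈ Finset.Icc (-(N : ℤ)) (-1), fourierCoef β k * t ^ k

/-- The Laurent polynomial approximation of the matrix function in reduced form. -/
def reducedTrunc (θ : ℤ) (α β : ℂ → ℂ) (N : ℕ) : MatFun :=
  reducedForm θ (truncPlus α N) (truncMinus β N)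

/-- The maximum of `|f|` on the circle `|t| = ζ`. -/
def maxCircle (f : ℂ → ℂ) (ζ : ℝ) : ℝ :=
  sSup ((fun t => ‖f t‖) '' Metric.sphere (0 : ℂ) ζ)

/-- The bound `δ_N(ζ₁, ζ₂)` for the distance between the matrix function and its truncation. -/
def delta (α β : ℂ → ℂ) (N : ℕ) (ζ₁ ζ₂ : ℝ) : ℝ :=
  (1 + ζ₂ * maxCircle α ζ₂ / (ζ₂ - 1)) * (ζ₁ ^ (N + 1) * maxCircle β ζ₁ / (1 - ζ₁)) +
    (1 + ζ₁ * maxCircle β ζ₁ / (1 - ζ₁)) * (maxCircle α ζ₂ / (ζ₂ ^ N * (ζ₂ - 1)))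

/-- The Wiener norm of the diagonal factor of a stable factorisation: `1` if `θ` is even and `2` if
`θ` is odd. -/
def sigma (θ : ℤ) : ℝ := if Even θ then 1 else 2

/-- The quantity `q_N(ζ₁, ζ₂)`, computed from the factors `Am`, `Ap` of the truncation. -/
def qValue (θ : ℤ) (α β : ℂ → ℂ) (N : ℕ) (Am Ap : MatFun) (ζ₁ ζ₂ : ℝ) : ℝ :=
  sigma θ * delta α β N ζ₁ ζ₂ * wienerNorm (matInv Ap) * wienerNorm (matInv Am)

/-- The admissible pairs: `r₁ < ζ₁ < 1 < ζ₂ < r₂`, where `ζ₁ = r₁` is admitted as well if `r₁ > 0` and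
`β` is continuous up to the circle `|t| = r₁`, and `ζ₂ = r₂` is admitted as well if `r₂ < ∞` and `α`
is continuous up to the circle `|t| = r₂`. -/
def admissible (r₁ : ℝ) (r₂ : ℝ≥0∞) (α β : ℂ → ℂ) : Set (ℝ × ℝ) :=
  {ζ | (ζ.1 < 1 ∧ (r₁ < ζ.1 ∨ (ζ.1 = r₁ ∧ 0 < r₁ ∧ ContinuousOn β {z | r₁ ≤ ‖z‖}))) ∧
    (1 < ζ.2 ∧ (ENNReal.ofReal ζ.2 < r₂ ∨
      (ENNReal.ofReal ζ.2 = r₂ ∧ ContinuousOn α {z | ENNReal.ofReal ‖z‖ ≤ r₂})))}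

end WienerHopf

end

/-! Let a contractive projection `p` split a Banach ring into a plus and a minus subalgebra. An
element `1 + e` with `e` small is a product of a minus factor and a plus factor: the inverse plus
factor solves the contraction equation `x' + p (e * x') = 1`, and the inverses of both factors are
bounded explicitly (`IsSplitting.exists_isCanonical_one_add`). If `b = y * x` is canonical and `c`
is near `b`, then `c = y * (1 + e) * x` with `e` small, so `c` has a canonical factorisation with
bounded inverses (`IsCanonical.exists_of_norm_sub_lt`). A Liouville argument gives uniqueness
(`IsCanonical.inv_unique`), so the bound holds for every such factorisation.

Stable `P`-normalised factorisations reduce to this case. Write `D` for the diagonal factor and let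
`Q` be `P`, or `1` if the partial indices agree; then `a = a₋ D a₊` becomes `D⁻¹ Q a = (D⁻¹ Q a₋ D)
a₊`. Conjugation by `D` shifts the off-diagonal entries by at most one power, and `P`-normalisation
says exactly that the conjugated minus factor is `1` plus negative powers (`isPNormalised_iff`).

By analyticity across the unit circle, `α` and `β` have absolutely summable Fourier coefficients, so
`a_N → a` in the Wiener algebra. For large `N` the factorisation therefore persists and the inverse
factors have norm at most a fixed `C`. Since `δ_N → 0` uniformly on compact sets of admissible
pairs, `q_N ≤ σ δ_N C²` is eventually less than one. No comparison of `δ_N` with the distance from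
`a_N` to `a` is needed. -/

open Filter Topology
open scoped ENNReal

noncomputable section

namespace WienerHopf

/-! ### Canonical factorisation in a split Banach ring. -/

section Canonical

variable {R : Type*} [NormedRing R]

/-- The Neumann series makes `x` a unit, so a right inverse is two-sided although the ring is
noncommutative. -/
lemma mul_eq_one_of_norm_sub_one_lt [CompleteSpace R] {x z : R} (hx : ‖x - 1‖ < 1)
    (h : x * z = 1) : z * x = 1 := by
  obtain ⟨u, hu⟩ : IsUnit x := by
    have := isUnit_one_sub_of_norm_lt_one (x := 1 - x) (by rwa [norm_sub_rev])
    simpa using this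
  subst hu
  rw [← Units.inv_eq_of_mul_eq_one_right h, Units.inv_mul]

/-- A contractive projection of a Banach algebra onto a unital subalgebra along a subalgebra. -/
structure IsSplitting (p : R →+ R) : Prop where
  norm_le : ∀ x, ‖p x‖ ≤ ‖x‖
  idem : ∀ x, p (p x) = p x
  one : p 1 = 1
  mul_plus : ∀ x y, p x = x → p y = y → p (x * y) = x * y
  mul_minus : ∀ x y, p x = 0 → p y = 0 → p (x * y) = 0

/-- A canonical factorisation `b = y * x` with respect to the splitting `p`, where `x`, with inverse
`x'`, is a plus factor, and `y`, with inverse `y'`, is a minus factor normalised at infinity. -/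
structure IsCanonical (p : R →+ R) (b y y' x x' : R) : Prop where
  eq : b = y * x
  y_mul : y * y' = 1
  mul_y : y' * y = 1
  x_mul : x * x' = 1
  mul_x : x' * x = 1
  y_minus : p (y - 1) = 0
  y'_minus : p (y' - 1) = 0
  x_plus : p x = x
  x'_plus : p x' = x'

variable {p : R →+ R}

/-- The map `z ↦ c - q (e * z)` contracts by the factor 1/2. It is applied to `p` with `C = 1` and
to the complementary projection with `C = 2`. -/
lemma exists_add_map_mul_eq [CompleteSpace R] (q : R →+ R) {C : ℝ} (hC : 0 ≤ C)
    (hq : ∀ x, ‖q x‖ ≤ C * ‖x‖) (e c : R) (he : C * ‖e‖ ≤ 1 / 2) :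
    ∃ z, z + q (e * z) = c ∧ ‖z‖ ≤ 2 * ‖c‖ := by
  have hf : ContractingWith (1 / 2) fun z => c - q (e * z) := by
    refine ⟨by rw [← NNReal.coe_lt_coe]; norm_num, LipschitzWith.of_dist_le_mul fun z w => ?_⟩
    rw [dist_eq_norm, dist_eq_norm, sub_sub_sub_cancel_left, ← map_sub, ← mul_sub, norm_sub_rev z w]
    calc ‖q (e * (w - z))‖ ≤ C * ‖e * (w - z)‖ := hq _
      _ ≤ C * (‖e‖ * ‖w - z‖) := by gcongr; exact norm_mul_le _ _
      _ = C * ‖e‖ * ‖w - z‖ := by ring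
      _ ≤ _ := by push_cast; gcongr
  set z := ContractingWith.fixedPoint _ hf with hz
  have h1 : c - q (e * z) = z := hf.fixedPoint_isFixedPt
  refine ⟨z, by rw [← sub_eq_iff_eq_add.1 h1], ?_⟩
  have h2 : ‖q (e * z)‖ ≤ 1 / 2 * ‖z‖ := by
    calc ‖q (e * z)‖ ≤ C * ‖e * z‖ := hq _
      _ ≤ C * (‖e‖ * ‖z‖) := by gcongr; exact norm_mul_le _ _
      _ = C * ‖e‖ * ‖z‖ := by ring
      _ ≤ 1 / 2 * ‖z‖ := by gcongr
  have h3 : ‖z‖ ≤ ‖c‖ + ‖q (e * z)‖ := by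
    calc ‖z‖ = ‖c - q (e * z)‖ := by rw [h1]
      _ ≤ _ := norm_sub_le _ _
  linarith

/-- Elements close to the unit have a canonical factorisation. -/
lemma IsSplitting.exists_isCanonical_one_add [CompleteSpace R] (hp : IsSplitting p) {e : R}
    (he : ‖e‖ ≤ 1 / 2) (he' : ‖e‖ * ‖(1 : R)‖ ≤ 1 / 24) :
    ∃ y y' x x', IsCanonical p (1 + e) y y' x x' ∧ ‖x'‖ ≤ 2 * ‖(1 : R)‖ ∧
      ‖y'‖ ≤ 1 + ‖(1 : R)‖ := by
  -- For `x'` plus, the equation says that `(1 + e) * x' - 1` is minus.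
  obtain ⟨x', hx', hx'n⟩ := exists_add_map_mul_eq p zero_le_one (by simpa using hp.norm_le) e 1
    (by simpa using he)
  -- The constant 1/24 yields 1/12 here and `‖y - 1‖ ≤ 1/6` below, small enough for the contraction
  -- with `C = 2`.
  have hex : ‖e * x'‖ ≤ 1 / 12 := by
    calc ‖e * x'‖ ≤ ‖e‖ * ‖x'‖ := norm_mul_le _ _
      _ ≤ ‖e‖ * (2 * ‖(1 : R)‖) := by gcongr
      _ ≤ 1 / 12 := by linarith
  have hpx : ‖p (e * x')‖ ≤ 1 / 12 := (hp.norm_le _).trans hex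
  have hx1 : x' - 1 = -p (e * x') := by rw [← hx']; abel
  have hx1n : ‖x' - 1‖ ≤ 1 / 12 := by rwa [hx1, norm_neg]
  have hx1p : p (x' - 1) = x' - 1 := by rw [hx1, map_neg, hp.idem]
  have hx'p : p x' = x' := by
    have := hx1p
    rwa [map_sub, hp.one, sub_left_inj] at this
  -- Solving the projected equation forces `x` to be plus; the projection then acts trivially and
  -- `x' * x = 1` remains.
  obtain ⟨x, hx, -⟩ := exists_add_map_mul_eq p zero_le_one (by simpa using hp.norm_le) (x' - 1) 1
    (by linarith)
  have hxp : p x = x := by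
    have : x = 1 - p ((x' - 1) * x) := eq_sub_of_add_eq hx
    rw [this, map_sub, hp.one, hp.idem]
  have hxx : x' * x = 1 := by
    rw [hp.mul_plus _ _ hx1p hxp] at hx
    rw [← hx]; noncomm_ring
  have hxx' : x * x' = 1 := mul_eq_one_of_norm_sub_one_lt (by linarith) hxx
  set y := (1 + e) * x' with hy
  have hy1 : y - 1 = e * x' - p (e * x') := by
    rw [hy, add_mul, one_mul, ← sub_eq_zero]
    have : x' = 1 - p (e * x') := by rw [← hx']; abel
    nth_rewrite 1 [this]
    abel
  have hy1n : ‖y - 1‖ ≤ 1 / 6 := by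
    rw [hy1]
    exact (norm_sub_le _ _).trans (by linarith)
  have hy1p : p (y - 1) = 0 := by rw [hy1, map_sub, hp.idem, sub_self]
  -- The same device inverts `y` within `1` plus the minus part.
  let q : R →+ R := AddMonoidHom.id R - p
  have hq : ∀ z, q z = z - p z := fun z => rfl
  have hpq : ∀ z, p (q z) = 0 := fun z => by rw [hq, map_sub, hp.idem, sub_self]
  obtain ⟨w, hw, hwn⟩ := exists_add_map_mul_eq q (C := 2) (by norm_num)
    (fun z => by
      rw [hq]
      exact (norm_sub_le _ _).trans (by linarith [hp.norm_le z])) (y - 1) (-(y - 1)) (by linarith)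
  have hwp : p w = 0 := by
    have : w = -(y - 1) - q ((y - 1) * w) := by rw [← hw]; abel
    rw [this, map_sub, map_neg, hy1p, hpq, neg_zero, sub_zero]
  have hyy : y * (1 + w) = 1 := by
    rw [hq, hp.mul_minus _ _ hy1p hwp, sub_zero] at hw
    have : y * (1 + w) - 1 = (w + (y - 1) * w) + (y - 1) := by noncomm_ring
    rw [← sub_eq_zero, this, hw]
    abel
  refine ⟨y, 1 + w, x, x', ⟨?_, hyy, mul_eq_one_of_norm_sub_one_lt (by linarith) hyy, hxx', hxx,
    hy1p, by simpa using hwp, hxp, hx'p⟩, hx'n, ?_⟩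
  · rw [hy, mul_assoc, hxx, mul_one]
  · refine (norm_add_le _ _).trans ?_
    rw [norm_neg] at hwn
    linarith

/-- The minus part is closed under products but lacks the unit, so the factors normalised at
infinity are handled through their differences from 1. -/
lemma IsSplitting.mul_sub_one (hp : IsSplitting p) {y z : R} (hy : p (y - 1) = 0)
    (hz : p (z - 1) = 0) : p (y * z - 1) = 0 := by
  have : y * z - 1 = (y - 1) * (z - 1) + (y - 1) + (z - 1) := by noncomm_ring
  rw [this, map_add, map_add, hp.mul_minus _ _ hy hz, hy, hz]
  simp

/-- The canonical factorisation is unique. -/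
lemma IsCanonical.inv_unique (hp : IsSplitting p) {b y y' x x' z z' w w' : R}
    (h : IsCanonical p b y y' x x') (h' : IsCanonical p b z z' w w') : y' = z' ∧ x' = w' := by
  -- The left side is 1 plus a minus element and the right side is plus, so both equal 1.
  have h1 : z' * y = w * x' := by
    have : z' * (y * x) * x' = z' * (z * w) * x' := by rw [← h.eq, ← h'.eq]
    rw [← mul_assoc, mul_assoc, h.x_mul, mul_one, ← mul_assoc, h'.mul_y, one_mul] at this
    exact this
  have h2 : z' * y - 1 = 0 := by
    rw [← hp.mul_sub_one h'.y'_minus h.y_minus, map_sub, hp.one, h1,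
      hp.mul_plus _ _ h'.x_plus h.x'_plus]
  have h3 : z' * y = 1 := sub_eq_zero.1 h2
  refine ⟨?_, ?_⟩
  · calc y' = z' * y * y' := by rw [h3, one_mul]
      _ = z' := by rw [mul_assoc, h.y_mul, mul_one]
  · calc x' = w' * (w * x') := by rw [← mul_assoc, h'.mul_x, one_mul]
      _ = w' := by rw [← h1, h3, mul_one]

/-- The canonical factorisation is stable under small perturbations, and the inverses of the
factors stay bounded. -/
lemma IsCanonical.exists_of_norm_sub_lt [CompleteSpace R] (hp : IsSplitting p)
    {b y y' x x' : R} (h : IsCanonical p b y y' x x') :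
    ∃ ε > 0, ∃ C, ∀ c, ‖c - b‖ < ε → ∃ z z' w w', IsCanonical p c z z' w w' ∧
      ‖z'‖ ≤ C ∧ ‖w'‖ ≤ C := by
  set M := ‖y'‖ * ‖x'‖ with hM
  have hM0 : 0 ≤ M := by positivity
  -- The bound `‖e‖ * D ≤ 1` contains both smallness conditions, `‖e‖ ≤ 1/2` and `‖e‖ * ‖1‖ ≤ 1/24`.
  set D := 2 + 24 * ‖(1 : R)‖ with hD
  have hD0 : 2 ≤ D := by have := norm_nonneg (1 : R); linarith
  refine ⟨1 / ((M + 1) * D), by positivity,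
    max ((1 + ‖(1 : R)‖) * ‖y'‖) (‖x'‖ * (2 * ‖(1 : R)‖)), fun c hc => ?_⟩
  -- Chosen so that `c = y * (1 + e) * x`.
  set e := y' * (c - b) * x' with he
  have hen : ‖e‖ * D ≤ 1 := by
    have h1 : ‖e‖ ≤ M * ‖c - b‖ := by
      calc ‖e‖ ≤ ‖y' * (c - b)‖ * ‖x'‖ := norm_mul_le _ _
        _ ≤ ‖y'‖ * ‖c - b‖ * ‖x'‖ := by gcongr; exact norm_mul_le _ _
        _ = M * ‖c - b‖ := by rw [hM]; ring
    have h2 : ‖c - b‖ * ((M + 1) * D) ≤ 1 := by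
      rw [lt_div_iff₀ (by positivity)] at hc
      exact hc.le
    have h3 : 0 ≤ ‖c - b‖ * D := by positivity
    calc ‖e‖ * D ≤ M * ‖c - b‖ * D := by gcongr
      _ ≤ 1 := by nlinarith
  have hen0 := norm_nonneg e
  have h10 : 0 ≤ ‖e‖ * ‖(1 : R)‖ := by positivity
  obtain ⟨u, u', v, v', huv, hv', hu'⟩ := hp.exists_isCanonical_one_add (e := e)
    (by rw [hD] at hen; nlinarith) (by rw [hD] at hen; nlinarith)
  refine ⟨y * u, u' * y', v * x, x' * v', ⟨?_, ?_, ?_, ?_, ?_, ?_, ?_, ?_, ?_⟩, ?_, ?_⟩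
  · have : y * u * (v * x) = y * (u * v) * x := by noncomm_ring
    rw [this, ← huv.eq, he]
    have : y * (1 + y' * (c - b) * x') * x = y * x + (y * y') * (c - b) * (x' * x) := by
      noncomm_ring
    rw [this, h.y_mul, h.mul_x, ← h.eq]
    noncomm_ring
  · calc y * u * (u' * y') = y * (u * u') * y' := by noncomm_ring
      _ = 1 := by rw [huv.y_mul, mul_one, h.y_mul]
  · calc u' * y' * (y * u) = u' * (y' * y) * u := by noncomm_ring
      _ = 1 := by rw [h.mul_y, mul_one, huv.mul_y]
  · calc v * x * (x' * v') = v * (x * x') * v' := by noncomm_ring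
      _ = 1 := by rw [h.x_mul, mul_one, huv.x_mul]
  · calc x' * v' * (v * x) = x' * (v' * v) * x := by noncomm_ring
      _ = 1 := by rw [huv.mul_x, mul_one, h.mul_x]
  · exact hp.mul_sub_one h.y_minus huv.y_minus
  · exact hp.mul_sub_one huv.y'_minus h.y'_minus
  · exact hp.mul_plus _ _ huv.x_plus h.x_plus
  · exact hp.mul_plus _ _ h.x'_plus huv.x'_plus
  · refine le_max_of_le_left ((norm_mul_le _ _).trans ?_)
    gcongr
  · refine le_max_of_le_right ((norm_mul_le _ _).trans ?_)
    gcongr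

end Canonical

/-- The Wiener algebra of the circle, modelled by the absolutely summable two-sided sequences of
Fourier coefficients. -/
def WienerSeq : Type := lp (fun _ : ℤ => ℂ) 1

/-! ### The scalar Wiener algebra: sequences, convolution and evaluation. -/

namespace WienerSeq

instance : NormedAddCommGroup WienerSeq :=
  inferInstanceAs (NormedAddCommGroup (lp (fun _ : ℤ => ℂ) 1))

instance : NormedSpace ℂ WienerSeq :=
  inferInstanceAs (NormedSpace ℂ (lp (fun _ : ℤ => ℂ) 1))

instance : CompleteSpace WienerSeq :=
  inferInstanceAs (CompleteSpace (lp (fun _ : ℤ => ℂ) 1))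

instance : FunLike WienerSeq ℤ ℂ where
  coe x := x.1
  coe_injective _ _ h := lp.ext h

@[ext] lemma ext {x y : WienerSeq} (h : ∀ k, x k = y k) : x = y := DFunLike.ext _ _ h

@[simp] lemma add_apply (x y : WienerSeq) (k : ℤ) : (x + y) k = x k + y k := rfl
@[simp] lemma sub_apply (x y : WienerSeq) (k : ℤ) : (x - y) k = x k - y k := rfl
@[simp] lemma neg_apply (x : WienerSeq) (k : ℤ) : (-x) k = -x k := rfl
@[simp] lemma zero_apply (k : ℤ) : (0 : WienerSeq) k = 0 := rfl
@[simp] lemma smul_apply (c : ℂ) (x : WienerSeq) (k : ℤ) : (c • x) k = c * x k := rfl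

lemma hasSum_norm (x : WienerSeq) : HasSum (fun k => ‖x k‖) ‖x‖ := by
  have h := lp.hasSum_norm (E := fun _ : ℤ => ℂ) (p := 1) (by simp) x
  simp only [ENNReal.toReal_one, Real.rpow_one] at h
  exact h

lemma norm_apply_le (x : WienerSeq) (k : ℤ) : ‖x k‖ ≤ ‖x‖ :=
  lp.norm_apply_le_norm (E := fun _ : ℤ => ℂ) one_ne_zero x k

/-- The element with prescribed Fourier coefficients. -/
def ofSummable (f : ℤ → ℂ) (hf : Summable fun k => ‖f k‖) : WienerSeq :=
  ⟨f, memℓp_gen (by simpa using hf)⟩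

@[simp] lemma ofSummable_apply (f : ℤ → ℂ) (hf : Summable fun k => ‖f k‖) (k : ℤ) :
    ofSummable f hf k = f k := rfl

/-- The `k`-th Fourier coefficient as a continuous linear functional. -/
def coef (k : ℤ) : WienerSeq →L[ℂ] ℂ :=
  LinearMap.mkContinuous
    { toFun := fun x => x k, map_add' := fun _ _ => rfl, map_smul' := fun _ _ => rfl } 1
    fun x => by rw [one_mul]; exact norm_apply_le x k

@[simp] lemma coef_apply (k : ℤ) (x : WienerSeq) : coef k x = x k := rfl

/-- Multiplication by the monomial `t ^ k`. -/
def shift (k : ℤ) : WienerSeq →ₗᵢ[ℂ] WienerSeq where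
  toFun x := ofSummable (fun n => x (n - k))
    (((Equiv.subRight k).summable_iff (f := fun n => ‖x n‖)).2 x.hasSum_norm.summable)
  map_add' _ _ := rfl
  map_smul' _ _ := rfl
  norm_map' x := by
    exact (hasSum_norm _).unique ((Equiv.subRight k).hasSum_iff.2 x.hasSum_norm)

@[simp] lemma shift_apply (k n : ℤ) (x : WienerSeq) : shift k x n = x (n - k) := rfl

/-- The monomial `t ^ k`. -/
def monomial (k : ℤ) : WienerSeq := lp.single 1 k (1 : ℂ)

lemma monomial_apply (k n : ℤ) : monomial k n = if n = k then 1 else 0 := by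
  by_cases h : n = k
  · rw [if_pos h, h]
    exact lp.single_apply_self (E := fun _ : ℤ => ℂ) 1 k (1 : ℂ)
  · rw [if_neg h]
    exact lp.single_apply_ne (E := fun _ : ℤ => ℂ) 1 k (1 : ℂ) h

lemma hasSum_monomial (x : WienerSeq) : HasSum (fun k => x k • monomial k) x := by
  have h := lp.hasSum_single (E := fun _ : ℤ => ℂ) (p := 1) (by simp) x
  have h' : (fun k => x k • monomial k) = fun k => lp.single 1 k (x.1 k) := by
    funext k
    have := lp.single_smul (E := fun _ : ℤ => ℂ) (𝕜 := ℂ) 1 k (x k) (1 : ℂ)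
    rw [smul_eq_mul, mul_one] at this
    exact this.symm
  rw [h']
  exact h

/-- Convolution as a norm-convergent series of shifts, so that coefficients and evaluations can be
taken term by term. -/
instance : Mul WienerSeq := ⟨fun x y => ∑' k, x k • shift k y⟩
instance : One WienerSeq := ⟨monomial 0⟩

lemma one_apply (n : ℤ) : (1 : WienerSeq) n = if n = 0 then 1 else 0 := monomial_apply 0 n

lemma hasSum_norm_mul (x y : WienerSeq) :
    HasSum (fun k => ‖x k • shift k y‖) (‖x‖ * ‖y‖) := by
  simpa [norm_smul] using x.hasSum_norm.mul_right ‖y‖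

lemma hasSum_mul (x y : WienerSeq) : HasSum (fun k => x k • shift k y) (x * y) :=
  (Summable.of_norm (hasSum_norm_mul x y).summable).hasSum

lemma norm_mul_le' (x y : WienerSeq) : ‖x * y‖ ≤ ‖x‖ * ‖y‖ :=
  tsum_of_norm_bounded (hasSum_norm_mul x y) fun _ => le_rfl

lemma hasSum_mul_apply (x y : WienerSeq) (n : ℤ) :
    HasSum (fun k => x k * y (n - k)) ((x * y) n) := by
  simpa using (hasSum_mul x y).mapL (coef n)

lemma summable_ev (t : Circle) (x : WienerSeq) : Summable fun k => x k * (t : ℂ) ^ k :=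
  Summable.of_norm (by simpa [Circle.norm_coe] using x.hasSum_norm.summable)

/-- Evaluation at a point of the circle. -/
def ev (t : Circle) : WienerSeq →L[ℂ] ℂ :=
  LinearMap.mkContinuous
    { toFun := fun x => ∑' k, x k * (t : ℂ) ^ k
      map_add' := fun x y => by
        simp only [add_apply, add_mul]
        exact (summable_ev t x).tsum_add (summable_ev t y)
      map_smul' := fun c x => by simp [mul_assoc, tsum_mul_left] } 1
    fun x => by
      rw [one_mul]
      exact tsum_of_norm_bounded x.hasSum_norm fun k => by simp [Circle.norm_coe]

lemma hasSum_ev (t : Circle) (x : WienerSeq) : HasSum (fun k => x k * (t : ℂ) ^ k) (ev t x) :=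
  (summable_ev t x).hasSum

@[simp] lemma ev_monomial (t : Circle) (k : ℤ) : ev t (monomial k) = (t : ℂ) ^ k := by
  refine (hasSum_ev t _).unique ?_
  convert hasSum_ite_eq k ((t : ℂ) ^ k) using 2 with n
  rw [monomial_apply]
  split_ifs with h <;> simp [h]

@[simp] lemma ev_one (t : Circle) : ev t 1 = 1 := by
  exact (ev_monomial t 0).trans (zpow_zero _)

lemma ev_shift (t : Circle) (k : ℤ) (x : WienerSeq) :
    ev t (shift k x) = (t : ℂ) ^ k * ev t x := by
  refine (hasSum_ev t _).unique ?_
  have h := ((Equiv.subRight k).hasSum_iff.2 (hasSum_ev t x)).mul_left ((t : ℂ) ^ k)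
  refine h.congr_fun fun n => ?_
  simp only [shift_apply, Function.comp_apply, Equiv.subRight_apply,
    zpow_sub₀ (Circle.coe_ne_zero t)]
  have := zpow_ne_zero k (Circle.coe_ne_zero t)
  field_simp

@[simp] lemma ev_mul (t : Circle) (x y : WienerSeq) : ev t (x * y) = ev t x * ev t y := by
  have h := (hasSum_mul x y).mapL (ev t)
  refine h.unique ?_
  simpa [ev_shift, mul_assoc] using (hasSum_ev t x).mul_right (ev t y)

end WienerSeq

/-! ### Fourier coefficients of absolutely convergent series. -/

lemma circleAverage_zpow (k : ℤ) :
    Real.circleAverage (fun t : ℂ => t ^ k) 0 1 = if k = 0 then 1 else 0 := by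
  rw [Real.circleAverage_eq_circleIntegral one_ne_zero]
  have h : ∀ t ∈ Metric.sphere (0 : ℂ) 1, (t - 0)⁻¹ • t ^ k = (t - 0) ^ (k - 1) := by
    intro t ht
    have : t ≠ 0 := by rintro rfl; simp at ht
    simp [zpow_sub₀ this]; ring
  rw [circleIntegral.integral_congr zero_le_one h]
  split_ifs with hk
  · subst hk
    have := circleIntegral.integral_sub_center_inv (0 : ℂ) (R := 1) one_ne_zero
    simp only [zero_sub, zpow_neg_one] 
    rw [this, smul_eq_mul, inv_mul_cancel₀ Complex.two_pi_I_ne_zero]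
  · rw [circleIntegral.integral_sub_zpow_of_ne (by omega), smul_zero]

/-- The Fourier coefficients of an absolutely convergent Fourier series are its coefficients. -/
lemma fourierCoef_ev {f : ℂ → ℂ} {x : WienerSeq} (h : ∀ t : Circle, f t = x.ev t) (k : ℤ) :
    fourierCoef f k = x k := by
  have hc : ∀ φ : ℝ, circleMap 0 1 φ = (Circle.exp φ : ℂ) := fun φ => by simp [circleMap]
  have hsum : ∀ n : ℤ, Real.circleAverage (fun t => x n * t ^ (n - k)) 0 1 =
      if n = k then x k else 0 := by
    intro n
    have := Real.circleAverage_fun_smul (f := fun t : ℂ => t ^ (n - k)) (a := x n) (c := 0) (R := 1)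
    simp only [smul_eq_mul] at this
    rw [this, circleAverage_zpow]
    by_cases hn : n = k
    · simp [hn]
    · simp [hn, sub_eq_zero]
  -- Termwise integration, dominated by the summable constants `‖x n‖` since `|t| = 1`.
  have hH : HasSum (fun n : ℤ => ∫ φ in (0 : ℝ)..2 * Real.pi,
      x n * circleMap 0 1 φ ^ (n - k))
      (∫ φ in (0 : ℝ)..2 * Real.pi, circleMap 0 1 φ ^ (-k) * f (circleMap 0 1 φ)) := by
    refine intervalIntegral.hasSum_integral_of_dominated_convergence (fun n _ => ‖x n‖)
      (fun n => ?_) (fun n => ?_) ?_ ?_ ?_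
    · refine Continuous.aestronglyMeasurable ?_
      simp only [hc]
      exact continuous_const.mul ((continuous_subtype_val.comp Circle.exp.continuous).zpow₀ _
        fun φ => Or.inl (Circle.coe_ne_zero _))
    · refine Eventually.of_forall fun φ _ => ?_
      simp [hc]
    · exact Eventually.of_forall fun φ _ => x.hasSum_norm.summable
    · exact intervalIntegrable_const
    · refine Eventually.of_forall fun φ _ => ?_
      rw [hc, h]
      refine ((WienerSeq.hasSum_ev _ x).mul_left ((Circle.exp φ : ℂ) ^ (-k))).congr_fun fun n => ?_
      rw [sub_eq_neg_add, zpow_add₀ (Circle.coe_ne_zero _)]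
      ring
  have h2 := hH.const_smul (2 * Real.pi)⁻¹
  have h3 : HasSum (fun n : ℤ => if n = k then x k else 0) (fourierCoef f k) := by
    refine h2.congr_fun fun n => ?_
    rw [← hsum n]
    rfl
  exact h3.unique (hasSum_ite_eq k (x k))

/-! ### Ring structure, supports and the projection onto non-negative powers. -/

namespace WienerSeq

/-- The values on the circle determine the Fourier coefficients. This reduces the ring axioms, and
later all identities between series, to pointwise ones. -/
lemma ext_ev {x y : WienerSeq} (h : ∀ t, ev t x = ev t y) : x = y := by
  ext k
  let f : ℂ → ℂ := fun z => ∑' n, x n * z ^ n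
  have hx : ∀ t : Circle, f t = ev t x := fun t => rfl
  rw [← fourierCoef_ev hx, ← fourierCoef_ev fun t => (hx t).trans (h t)]

instance : NormedCommRing WienerSeq :=
  { (inferInstance : NormedAddCommGroup WienerSeq) with
    mul := (· * ·)
    one := 1
    mul_assoc := fun x y z => ext_ev fun t => by simp [mul_assoc]
    mul_comm := fun x y => ext_ev fun t => by simp [mul_comm]
    one_mul := fun x => ext_ev fun t => by simp
    mul_one := fun x => ext_ev fun t => by simp
    zero_mul := fun x => ext_ev fun t => by simp
    mul_zero := fun x => ext_ev fun t => by simp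
    left_distrib := fun x y z => ext_ev fun t => by simp [mul_add]
    right_distrib := fun x y z => ext_ev fun t => by simp [add_mul]
    norm_mul_le := norm_mul_le' }

/-- Evaluation at a point of the circle as a ring homomorphism. -/
def evHom (t : Circle) : WienerSeq →+* ℂ where
  toFun := ev t
  map_one' := ev_one t
  map_mul' := ev_mul t
  map_zero' := map_zero _
  map_add' := map_add _

@[simp] lemma evHom_apply (t : Circle) (x : WienerSeq) : evHom t x = ev t x := rfl

lemma monomial_mul (j : ℤ) (x : WienerSeq) : monomial j * x = shift j x :=
  ext_ev fun t => by simp [ev_shift]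

lemma monomial_mul_monomial (j k : ℤ) : monomial j * monomial k = monomial (j + k) :=
  ext_ev fun t => by simp [zpow_add₀ (Circle.coe_ne_zero t)]

lemma monomial_zero : monomial 0 = 1 := rfl

/-- The coefficients of the powers greater than `n` vanish. -/
def SuppLE (n : ℤ) (x : WienerSeq) : Prop := ∀ k, n < k → x k = 0

/-- The coefficients of the powers less than `n` vanish. -/
def SuppGE (n : ℤ) (x : WienerSeq) : Prop := ∀ k, k < n → x k = 0

lemma SuppLE.mul {m n : ℤ} {x y : WienerSeq} (hx : SuppLE m x) (hy : SuppLE n y) :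
    SuppLE (m + n) (x * y) := by
  intro k hk
  refine (hasSum_mul_apply x y k).unique ?_
  refine hasSum_zero.congr_fun fun j => ?_
  rcases lt_or_ge m j with h | h
  · rw [hx j h, zero_mul]
  · rw [hy (k - j) (by omega), mul_zero]

lemma SuppGE.mul {m n : ℤ} {x y : WienerSeq} (hx : SuppGE m x) (hy : SuppGE n y) :
    SuppGE (m + n) (x * y) := by
  intro k hk
  refine (hasSum_mul_apply x y k).unique ?_
  refine hasSum_zero.congr_fun fun j => ?_
  rcases lt_or_ge j m with h | h
  · rw [hx j h, zero_mul]
  · rw [hy (k - j) (by omega), mul_zero]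

lemma SuppLE.add {n : ℤ} {x y : WienerSeq} (hx : SuppLE n x) (hy : SuppLE n y) :
    SuppLE n (x + y) := fun k hk => by simp [hx k hk, hy k hk]

lemma SuppLE.neg {n : ℤ} {x : WienerSeq} (hx : SuppLE n x) : SuppLE n (-x) :=
  fun k hk => by simp [hx k hk]

lemma SuppLE.mono {m n : ℤ} {x : WienerSeq} (hx : SuppLE m x) (h : m ≤ n) : SuppLE n x :=
  fun k hk => hx k (h.trans_lt hk)

lemma SuppGE.add {n : ℤ} {x y : WienerSeq} (hx : SuppGE n x) (hy : SuppGE n y) :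
    SuppGE n (x + y) := fun k hk => by simp [hx k hk, hy k hk]

lemma suppLE_monomial (n : ℤ) : SuppLE n (monomial n) := fun k hk => by
  rw [monomial_apply, if_neg hk.ne']

lemma suppLE_one : SuppLE 0 1 := suppLE_monomial 0

lemma suppGE_one : SuppGE 0 1 := fun k hk => by rw [one_apply, if_neg hk.ne]

lemma suppLE_zero (n : ℤ) : SuppLE n 0 := fun _ _ => rfl

lemma suppGE_zero (n : ℤ) : SuppGE n 0 := fun _ _ => rfl

/-- The projection onto the Fourier series with non-negative powers only. -/
def projPlus : WienerSeq →L[ℂ] WienerSeq :=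
  LinearMap.mkContinuous
    { toFun := fun x => ofSummable (fun k => if 0 ≤ k then x k else 0)
        (x.hasSum_norm.summable.of_nonneg_of_le (fun _ => norm_nonneg _) fun k => by
          split_ifs <;> simp)
      map_add' := fun x y => by ext k; by_cases h : 0 ≤ k <;> simp [h]
      map_smul' := fun c x => by ext k; by_cases h : 0 ≤ k <;> simp [h] } 1
    fun x => by
      rw [one_mul]
      refine hasSum_le (fun k => ?_) (hasSum_norm _) x.hasSum_norm
      by_cases h : 0 ≤ k <;> simp [h]

lemma projPlus_apply (x : WienerSeq) (k : ℤ) : projPlus x k = if 0 ≤ k then x k else 0 := rfl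

lemma norm_projPlus_le (x : WienerSeq) : ‖projPlus x‖ ≤ ‖x‖ := by
  refine hasSum_le (fun k => ?_) (hasSum_norm _) x.hasSum_norm
  by_cases h : 0 ≤ k <;> simp [h, projPlus_apply]

lemma projPlus_eq_self_iff {x : WienerSeq} : projPlus x = x ↔ SuppGE 0 x := by
  refine ⟨fun h k hk => ?_, fun h => ?_⟩
  · rw [← h, projPlus_apply, if_neg hk.not_ge]
  · ext k
    rw [projPlus_apply]
    split_ifs with hk
    · rfl
    · exact (h k (not_le.1 hk)).symm

lemma projPlus_eq_zero_iff {x : WienerSeq} : projPlus x = 0 ↔ SuppLE (-1) x := by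
  refine ⟨fun h k hk => ?_, fun h => ?_⟩
  · have := DFunLike.congr_fun h k
    rwa [projPlus_apply, if_pos (by omega)] at this
  · ext k
    rw [projPlus_apply]
    split_ifs with hk
    · exact h k (by omega)
    · rfl

end WienerSeq

open WienerSeq

/-- The matrix Wiener algebra, as the matrices over the scalar Wiener algebra. -/
abbrev WienerMat : Type := Matrix (Fin 2) (Fin 2) WienerSeq

/-! ### The matrix Wiener algebra and the matrix functions it represents. -/

namespace WienerMat

instance : NormedRing WienerMat := Matrix.linftyOpNormedRing

instance : @CompleteSpace WienerMat PseudoMetricSpace.toUniformSpace :=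
  inferInstanceAs (CompleteSpace (Fin 2 → Fin 2 → WienerSeq))

lemma norm_le_sum (x : WienerMat) : ‖x‖ ≤ ∑ i, ∑ j, ‖x i j‖ := by
  rw [Matrix.linfty_opNorm_def]
  have : (Finset.univ.sup fun i => ∑ j, ‖x i j‖₊) ≤ ∑ i, ∑ j, ‖x i j‖₊ :=
    Finset.sup_le fun i _ => Finset.single_le_sum (f := fun i => ∑ j, ‖x i j‖₊)
      (fun _ _ => zero_le) (Finset.mem_univ i)
  exact_mod_cast this

lemma norm_entry_le (x : WienerMat) (i j : Fin 2) : ‖x i j‖ ≤ ‖x‖ := by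
  rw [Matrix.linfty_opNorm_def]
  have : ‖x i j‖₊ ≤ Finset.univ.sup fun i => ∑ j, ‖x i j‖₊ :=
    (Finset.single_le_sum (f := fun j => ‖x i j‖₊) (fun _ _ => zero_le) (Finset.mem_univ j)).trans
      (Finset.le_sup (f := fun i => ∑ j, ‖x i j‖₊) (Finset.mem_univ i))
  exact_mod_cast this

/-- The entrywise projection onto the Fourier series with non-negative powers only. -/
def projPlus : WienerMat →+ WienerMat :=
  WienerSeq.projPlus.toLinearMap.toAddMonoidHom.mapMatrix

@[simp] lemma projPlus_apply (x : WienerMat) (i j : Fin 2) :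
    projPlus x i j = WienerSeq.projPlus (x i j) := rfl

lemma projPlus_eq_self_iff {x : WienerMat} : projPlus x = x ↔ ∀ i j, SuppGE 0 (x i j) := by
  simp_rw [← Matrix.ext_iff, projPlus_apply, WienerSeq.projPlus_eq_self_iff]

lemma projPlus_eq_zero_iff {x : WienerMat} : projPlus x = 0 ↔ ∀ i j, SuppLE (-1) (x i j) := by
  simp_rw [← Matrix.ext_iff, projPlus_apply, Matrix.zero_apply, WienerSeq.projPlus_eq_zero_iff]

lemma suppLE_mul {m n : ℤ} {x y : WienerMat} (hx : ∀ i j, SuppLE m (x i j))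
    (hy : ∀ i j, SuppLE n (y i j)) (i j : Fin 2) : SuppLE (m + n) ((x * y) i j) := by
  rw [Matrix.mul_apply, Fin.sum_univ_two]
  exact ((hx _ _).mul (hy _ _)).add ((hx _ _).mul (hy _ _))

lemma suppGE_mul {m n : ℤ} {x y : WienerMat} (hx : ∀ i j, SuppGE m (x i j))
    (hy : ∀ i j, SuppGE n (y i j)) (i j : Fin 2) : SuppGE (m + n) ((x * y) i j) := by
  rw [Matrix.mul_apply, Fin.sum_univ_two]
  exact ((hx _ _).mul (hy _ _)).add ((hx _ _).mul (hy _ _))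

lemma suppLE_one (i j : Fin 2) : SuppLE 0 ((1 : WienerMat) i j) := by
  rw [Matrix.one_apply]
  split_ifs
  · exact WienerSeq.suppLE_one
  · exact suppLE_zero 0

lemma suppGE_one (i j : Fin 2) : SuppGE 0 ((1 : WienerMat) i j) := by
  rw [Matrix.one_apply]
  split_ifs
  · exact WienerSeq.suppGE_one
  · exact suppGE_zero 0

lemma isSplitting_projPlus : IsSplitting projPlus where
  norm_le x := by
    rw [Matrix.linfty_opNorm_def, Matrix.linfty_opNorm_def]
    refine NNReal.coe_le_coe.2 (Finset.sup_mono_fun fun i _ => Finset.sum_le_sum fun j _ => ?_)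
    exact WienerSeq.norm_projPlus_le _
  idem x := by
    rw [projPlus_eq_self_iff]
    intro i j k hk
    rw [projPlus_apply, WienerSeq.projPlus_apply, if_neg hk.not_ge]
  one := projPlus_eq_self_iff.2 suppGE_one
  mul_plus x y hx hy := by
    rw [projPlus_eq_self_iff] at *
    simpa using suppGE_mul hx hy
  mul_minus x y hx hy := by
    rw [projPlus_eq_zero_iff] at *
    exact fun i j => (suppLE_mul hx hy i j).mono (by norm_num)

/-- Evaluation at a point of the circle. -/
def ev (t : Circle) : WienerMat →+* Matrix (Fin 2) (Fin 2) ℂ := (evHom t).mapMatrix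

@[simp] lemma ev_apply (t : Circle) (x : WienerMat) (i j : Fin 2) :
    ev t x i j = WienerSeq.ev t (x i j) := rfl

lemma ext_ev {x y : WienerMat} (h : ∀ t, ev t x = ev t y) : x = y := by
  ext1 i j
  exact WienerSeq.ext_ev fun t => congrFun (congrFun (h t) i) j

/-- `x` is the Fourier series of the matrix function `A`. -/
def Represents (x : WienerMat) (A : MatFun) : Prop := ∀ t : Circle, A t = ev t x

/-- The matrix function with a given Fourier series. -/
def toMatFun (x : WienerMat) : MatFun := fun t => Matrix.of fun i j => ∑' k, x i j k * t ^ k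

lemma represents_toMatFun (x : WienerMat) : Represents x (toMatFun x) := fun _ => rfl

lemma Represents.matCoef_apply {x : WienerMat} {A : MatFun} (h : Represents x A) (k : ℤ)
    (i j : Fin 2) : matCoef A k i j = x i j k := by
  refine fourierCoef_ev (f := fun t => A t i j) (fun t => ?_) k
  simp only [h t, ev_apply]

lemma norm_le_colSumNorm (B : Matrix (Fin 2) (Fin 2) ℂ) (i j : Fin 2) :
    ‖B i j‖ ≤ colSumNorm B := by
  have h := fun i j => norm_nonneg (B i j)
  have h0 := h 0 0
  have h1 := h 0 1
  have h2 := h 1 0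
  have h3 := h 1 1
  unfold colSumNorm
  fin_cases i <;> fin_cases j <;> simp

lemma colSumNorm_le (B : Matrix (Fin 2) (Fin 2) ℂ) :
    colSumNorm B ≤ ‖B 0 0‖ + ‖B 1 0‖ + (‖B 0 1‖ + ‖B 1 1‖) :=
  max_le_add_of_nonneg (by positivity) (by positivity)

lemma colSumNorm_nonneg (B : Matrix (Fin 2) (Fin 2) ℂ) : 0 ≤ colSumNorm B :=
  (norm_nonneg _).trans (norm_le_colSumNorm B 0 0)

lemma Represents.hasSum_bound {x : WienerMat} {A : MatFun} (h : Represents x A) :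
    HasSum (fun k => ‖matCoef A k 0 0‖ + ‖matCoef A k 1 0‖ +
      (‖matCoef A k 0 1‖ + ‖matCoef A k 1 1‖))
      (‖x 0 0‖ + ‖x 1 0‖ + (‖x 0 1‖ + ‖x 1 1‖)) := by
  simp only [h.matCoef_apply]
  exact ((hasSum_norm _).add (hasSum_norm _)).add ((hasSum_norm _).add (hasSum_norm _))

lemma Represents.summable {x : WienerMat} {A : MatFun} (h : Represents x A) :
    Summable fun k => colSumNorm (matCoef A k) :=
  h.hasSum_bound.summable.of_nonneg_of_le (fun _ => colSumNorm_nonneg _) fun _ => colSumNorm_le _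

lemma Represents.memWiener {x : WienerMat} {A : MatFun} (h : Represents x A) : MemWiener A := by
  refine ⟨h.summable, fun t ht => ?_⟩
  refine Pi.hasSum.2 fun i => Pi.hasSum.2 fun j => ?_
  have := hasSum_ev ⟨t, mem_sphere_zero_iff_norm.2 ht⟩ (x i j)
  have hA : A t i j = WienerSeq.ev ⟨t, mem_sphere_zero_iff_norm.2 ht⟩ (x i j) :=
    congrFun (congrFun (h ⟨t, mem_sphere_zero_iff_norm.2 ht⟩) i) j
  rw [hA]
  refine this.congr_fun fun k => ?_
  rw [Matrix.smul_apply, h.matCoef_apply, smul_eq_mul, mul_comm]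

/-- The ring norm is built from row sums, `wienerNorm` from column sums of the coefficients. The
crude factor 4 counts the entries; only boundedness matters. -/
lemma Represents.wienerNorm_le {x : WienerMat} {A : MatFun} (h : Represents x A) :
    wienerNorm A ≤ 4 * ‖x‖ := by
  calc wienerNorm A ≤ ‖x 0 0‖ + ‖x 1 0‖ + (‖x 0 1‖ + ‖x 1 1‖) :=
        hasSum_le (fun k => colSumNorm_le _) h.summable.hasSum h.hasSum_bound
    _ ≤ 4 * ‖x‖ := by
      linarith [norm_entry_le x 0 0, norm_entry_le x 0 1, norm_entry_le x 1 0, norm_entry_le x 1 1]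

lemma exists_represents {A : MatFun} (h : MemWiener A) : ∃ x, Represents x A := by
  refine ⟨Matrix.of fun i j => ofSummable (fun k => matCoef A k i j)
    (h.1.of_nonneg_of_le (fun _ => norm_nonneg _) fun k => norm_le_colSumNorm _ i j), fun t => ?_⟩
  ext i j
  have h1 := Pi.hasSum.1 (Pi.hasSum.1 (h.2 t t.norm_coe) i) j
  refine h1.unique ?_
  refine (hasSum_ev t _).congr_fun fun k => ?_
  simp [mul_comm]

lemma Represents.matInv {x y : WienerMat} {A : MatFun} (h : Represents x A) (hxy : x * y = 1) :
    Represents y (matInv A) := fun t => by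
  rw [WienerHopf.matInv, h t]
  refine Matrix.inv_eq_right_inv ?_
  rw [← map_mul, hxy, map_one]

lemma Represents.mul_eq_one {x y : WienerMat} {A : MatFun} (h : Represents x A)
    (h' : Represents y (WienerHopf.matInv A)) (hu : ∀ t : ℂ, ‖t‖ = 1 → IsUnit (A t)) :
    x * y = 1 := ext_ev fun t => by
  rw [map_mul, map_one, ← h t, ← h' t, WienerHopf.matInv]
  exact Matrix.mul_nonsing_inv _ ((Matrix.isUnit_iff_isUnit_det _).1 (hu t t.norm_coe))

lemma Represents.isUnit {x y : WienerMat} {A : MatFun} (h : Represents x A) (hxy : x * y = 1)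
    (t : ℂ) (ht : ‖t‖ = 1) : IsUnit (A t) := by
  rw [h ⟨t, mem_sphere_zero_iff_norm.2 ht⟩]
  exact (IsUnit.of_mul_eq_one y hxy).map _

lemma Represents.memWienerPlus {x : WienerMat} {A : MatFun} (h : Represents x A)
    (hx : ∀ i j, SuppGE 0 (x i j)) : MemWienerPlus A :=
  ⟨h.memWiener, fun k hk => by ext i j; rw [h.matCoef_apply, hx i j k hk, Matrix.zero_apply]⟩

lemma Represents.memWienerMinus {x : WienerMat} {A : MatFun} (h : Represents x A)
    (hx : ∀ i j, SuppLE 0 (x i j)) : MemWienerMinus A :=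
  ⟨h.memWiener, fun k hk => by ext i j; rw [h.matCoef_apply, hx i j k hk, Matrix.zero_apply]⟩

lemma Represents.suppGE {x : WienerMat} {A : MatFun} (h : Represents x A)
    (hA : MemWienerPlus A) (i j : Fin 2) : SuppGE 0 (x i j) := fun k hk => by
  rw [← h.matCoef_apply, hA.2 k hk, Matrix.zero_apply]

lemma Represents.suppLE {x : WienerMat} {A : MatFun} (h : Represents x A)
    (hA : MemWienerMinus A) (i j : Fin 2) : SuppLE 0 (x i j) := fun k hk => by
  rw [← h.matCoef_apply, hA.2 k hk, Matrix.zero_apply]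

end WienerMat

/-! ### Stable `P`-normalised factorisations as canonical factorisations. -/

namespace WienerMat

/-- The Fourier series of the diagonal factor `diag (t ^ ρ₁, t ^ ρ₂)`. -/
def diag (ρ₁ ρ₂ : ℤ) : WienerMat := !![monomial ρ₁, 0; 0, monomial ρ₂]

lemma represents_diag (ρ₁ ρ₂ : ℤ) : Represents (diag ρ₁ ρ₂) (diagFactor ρ₁ ρ₂) := fun t => by
  ext i j
  fin_cases i <;> fin_cases j <;> simp [diag, diagFactor]

lemma diag_mul_diag_neg (ρ₁ ρ₂ : ℤ) : diag ρ₁ ρ₂ * diag (-ρ₁) (-ρ₂) = 1 := by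
  simp [diag, monomial_mul_monomial, monomial_zero, Matrix.one_fin_two]

lemma diag_neg_mul_diag (ρ₁ ρ₂ : ℤ) : diag (-ρ₁) (-ρ₂) * diag ρ₁ ρ₂ = 1 := by
  simpa using diag_mul_diag_neg (-ρ₁) (-ρ₂)

/-- Conjugation by the diagonal factor. -/
def conj (ρ₁ ρ₂ : ℤ) (m : WienerMat) : WienerMat := diag (-ρ₁) (-ρ₂) * m * diag ρ₁ ρ₂

/-- Only the off-diagonal entries move, in opposite directions, by the gap of the partial indices,
which is 0 or 1 in the stable case. -/
lemma conj_eq (ρ₁ ρ₂ : ℤ) (m : WienerMat) :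
    conj ρ₁ ρ₂ m = !![m 0 0, shift (ρ₂ - ρ₁) (m 0 1); shift (ρ₁ - ρ₂) (m 1 0), m 1 1] := by
  have h : ∀ (j k : ℤ) (x : WienerSeq), monomial (-j) * x * monomial k = shift (k - j) x := by
    intro j k x
    rw [← monomial_mul, mul_right_comm, monomial_mul_monomial, neg_add_eq_sub]
  have h0 : ∀ x : WienerSeq, shift 0 x = x := fun x => by ext k; simp
  ext1 i j
  fin_cases i <;> fin_cases j <;> 
    simp [conj, diag, Matrix.mul_apply, Matrix.vecMul, dotProduct, Fin.sum_univ_two, h, h0]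

lemma conj_mul (ρ₁ ρ₂ : ℤ) (m n : WienerMat) :
    conj ρ₁ ρ₂ m * conj ρ₁ ρ₂ n = conj ρ₁ ρ₂ (m * n) := by
  have : conj ρ₁ ρ₂ m * conj ρ₁ ρ₂ n =
      diag (-ρ₁) (-ρ₂) * m * (diag ρ₁ ρ₂ * diag (-ρ₁) (-ρ₂)) * n * diag ρ₁ ρ₂ := by
    simp only [conj, mul_assoc]
  rw [this, diag_mul_diag_neg, mul_one, conj, mul_assoc (diag (-ρ₁) (-ρ₂)) m n]

lemma conj_one (ρ₁ ρ₂ : ℤ) : conj ρ₁ ρ₂ 1 = 1 := by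
  rw [conj, mul_one, diag_neg_mul_diag]

/-- The normalisation of a minus factor at infinity, in terms of single Fourier coefficients. -/
lemma projPlus_conj_sub_one_eq_zero_iff {ρ₁ ρ₂ : ℤ} (hρ : ρ₁ = ρ₂ ∨ ρ₂ = ρ₁ + 1) (m : WienerMat) :
    projPlus (conj ρ₁ ρ₂ m - 1) = 0 ↔ (∀ i j, SuppLE 0 (m i j)) ∧ m 0 0 0 = 1 ∧ m 1 1 0 = 1 ∧
      m 0 1 0 = 0 ∧ (ρ₁ = ρ₂ → m 1 0 0 = 0) ∧ (ρ₂ = ρ₁ + 1 → m 0 1 (-1) = 0) := by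
  rw [projPlus_eq_zero_iff, conj_eq]
  simp only [Fin.forall_fin_two, Matrix.sub_apply, Matrix.of_apply, Matrix.cons_val', SuppLE,
    Matrix.cons_val_zero, Matrix.cons_val_one, Matrix.cons_val_fin_one, Matrix.one_apply_eq,
    WienerSeq.sub_apply, one_apply, shift_apply, ne_eq, zero_ne_one, one_ne_zero,
    not_false_eq_true, Matrix.one_apply_ne, WienerSeq.zero_apply, sub_zero]
  constructor
  · rintro ⟨⟨h00, h01⟩, h10, h11⟩
    -- With gap 1 the upper right entry must also lose its coefficient at `-1`, while the lower left
    -- one keeps a free constant term.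
    have h01' : ∀ k, -1 - (ρ₂ - ρ₁) < k → m 0 1 k = 0 := fun k hk => by
      simpa using h01 (k + (ρ₂ - ρ₁)) (by omega)
    have h10' : ∀ k, -1 + (ρ₂ - ρ₁) < k → m 1 0 k = 0 := fun k hk => by
      simpa using h10 (k + (ρ₁ - ρ₂)) (by omega)
    refine ⟨⟨⟨fun k hk => ?_, fun k hk => h01' k (by omega)⟩, fun k hk => h10' k (by omega),
      fun k hk => ?_⟩, ?_, ?_, h01' 0 (by omega), fun h => h10' 0 (by omega),
      fun h => h01' _ (by omega)⟩
    · simpa [hk.ne'] using h00 k (by omega)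
    · simpa [hk.ne'] using h11 k (by omega)
    · simpa [sub_eq_zero] using h00 0 (by omega)
    · simpa [sub_eq_zero] using h11 0 (by omega)
  · rintro ⟨⟨⟨h00, h01⟩, h10, h11⟩, h1, h2, h3, h4, h5⟩
    have key : ∀ k : ℤ, -1 < k → k = 0 ∨ 0 < k := fun k hk => by omega
    refine ⟨⟨fun k hk => ?_, fun k hk => ?_⟩, fun k hk => ?_, fun k hk => ?_⟩
    · rcases key k hk with rfl | h
      · simp [h1]
      · simp [h00 k h, h.ne']
    · rcases hρ with h | h
      · rcases key k hk with rfl | h'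
        · simp [h, h3]
        · exact h01 _ (by omega)
      · rcases key k hk with rfl | h'
        · rw [← h5 h]; congr 1; omega
        · rcases eq_or_lt_of_le (show 1 ≤ k by omega) with rfl | h6
          · rw [← h3]; congr 1; omega
          · exact h01 _ (by omega)
    · rcases hρ with h | h
      · rcases key k hk with rfl | h'
        · rw [← h4 h]; congr 1; omega
        · exact h10 _ (by omega)
      · exact h10 _ (by omega)
    · rcases key k hk with rfl | h
      · simp [h2]
      · simp [h11 k h, h.ne']

/-- The inverse of a normalised minus factor is normalised. -/
lemma projPlus_conj_inv_sub_one_eq_zero {ρ₁ ρ₂ : ℤ} (hρ : ρ₁ = ρ₂ ∨ ρ₂ = ρ₁ + 1)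
    {m m' : WienerMat} (h : projPlus (conj ρ₁ ρ₂ m - 1) = 0) (hm' : ∀ i j, SuppLE 0 (m' i j))
    (hmm : m * m' = 1) : projPlus (conj ρ₁ ρ₂ m' - 1) = 0 := by
  have hmm' : m' * m = 1 := mul_eq_one_comm.1 hmm
  obtain ⟨hm, -, -, h01, -, h01'⟩ := (projPlus_conj_sub_one_eq_zero_iff hρ m).1 h
  have hdet : SuppLE 0 m'.det := by
    rw [Matrix.det_fin_two, sub_eq_add_neg]
    exact ((hm' _ _).mul (hm' _ _)).add ((hm' _ _).mul (hm' _ _)).neg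
  -- The adjugate of a 2 × 2 matrix transfers the vanishing of coefficients from `m 0 1` to the same
  -- entry of the inverse.
  have hadj : m' 0 1 = -(m 0 1 * m'.det) := by
    have h1 : m'.adjugate = m'.det • m := by
      have : m'.adjugate * m' * m = m'.adjugate := by rw [mul_assoc, hmm', mul_one]
      rw [← this, Matrix.adjugate_mul, Matrix.smul_mul, one_mul]
    have h2 := congrFun (congrFun h1 0) 1
    rw [Matrix.adjugate_fin_two, Matrix.smul_apply, smul_eq_mul] at h2
    simp only [Matrix.of_apply, Matrix.cons_val', Matrix.cons_val_one, Matrix.cons_val_fin_one,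
      Matrix.cons_val_zero] at h2
    rw [← neg_eq_iff_eq_neg, h2, mul_comm]
  have hsupp : ∀ i j, SuppLE 0 (conj ρ₁ ρ₂ m' i j) := by
    rw [conj_eq]
    simp only [Fin.forall_fin_two, Matrix.of_apply, Matrix.cons_val',
      Matrix.cons_val_zero, Matrix.cons_val_one, Matrix.cons_val_fin_one]
    refine ⟨⟨hm' _ _, fun k hk => ?_⟩, fun k hk => ?_, hm' _ _⟩
    · rw [shift_apply]
      rcases hρ with rfl | rfl
      · exact hm' 0 1 _ (by omega)
      -- The normalisation removes the powers 0 and -1, so after the shift by one only negative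
      -- powers are left.
      · have hs : SuppLE (-2) (m 0 1) := fun l hl => by
          rcases lt_trichotomy 0 l with h | rfl | h
          · exact hm 0 1 l h
          · exact h01
          · obtain rfl : l = -1 := by omega
            exact h01' rfl
        rw [hadj]
        exact (hs.mul hdet).neg _ (by omega)
    · exact hm' 1 0 _ (by omega)
  -- The identity `u⁻¹ - 1 = -(u - 1) * u⁻¹` has orders -1 and 0 on the right, hence order -1 in
  -- total.
  have hinv : conj ρ₁ ρ₂ m' - 1 = -((conj ρ₁ ρ₂ m - 1) * conj ρ₁ ρ₂ m') := by
    rw [sub_mul, conj_mul, hmm, conj_one, one_mul]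
    abel
  rw [hinv, map_neg, neg_eq_zero, projPlus_eq_zero_iff]
  rw [projPlus_eq_zero_iff] at h
  simpa using suppLE_mul h hsupp

/-- The Fourier series of the constant matrix function with value `P` or `1`, according to whether
the partial indices are different or equal. -/
def normaliser (P : Matrix (Fin 2) (Fin 2) ℂ) (ρ₁ ρ₂ : ℤ) : WienerMat :=
  if ρ₁ ≠ ρ₂ ∧ P = J₂ then !![0, 1; 1, 0] else 1

lemma normaliser_mul_self (P : Matrix (Fin 2) (Fin 2) ℂ) (ρ₁ ρ₂ : ℤ) :
    normaliser P ρ₁ ρ₂ * normaliser P ρ₁ ρ₂ = 1 := by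
  unfold normaliser
  split_ifs
  · simp [Matrix.one_fin_two]
  · rw [one_mul]

lemma normaliser_supp (P : Matrix (Fin 2) (Fin 2) ℂ) (ρ₁ ρ₂ : ℤ) (i j : Fin 2) :
    SuppLE 0 (normaliser P ρ₁ ρ₂ i j) := by
  unfold normaliser
  split_ifs
  · fin_cases i <;> fin_cases j
    exacts [suppLE_zero 0, WienerSeq.suppLE_one, WienerSeq.suppLE_one, suppLE_zero 0]
  · exact suppLE_one i j

lemma J₂_ne_one : J₂ ≠ 1 := fun h => by
  simpa [J₂] using congrFun (congrFun h 0) 0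

lemma J₂_inv : J₂⁻¹ = J₂ := Matrix.inv_eq_left_inv (by simp [J₂, Matrix.one_fin_two])

/-- `P`-normalisation of a minus factor as a normalisation at infinity. -/
lemma isPNormalised_iff {P : Matrix (Fin 2) (Fin 2) ℂ} (hP : P = 1 ∨ P = J₂) {ρ₁ ρ₂ : ℤ}
    (hρ : ρ₁ = ρ₂ ∨ ρ₂ = ρ₁ + 1) {x : WienerMat} {A : MatFun} (hA : Represents x A)
    (hx : ∀ i j, SuppLE 0 (x i j)) :
    IsPNormalised P ρ₁ ρ₂ A ↔
      projPlus (conj ρ₁ ρ₂ (normaliser P ρ₁ ρ₂ * x) - 1) = 0 := by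
  rw [projPlus_conj_sub_one_eq_zero_iff hρ]
  have hs : ∀ i j, SuppLE 0 ((normaliser P ρ₁ ρ₂ * x) i j) := by
    simpa using suppLE_mul (normaliser_supp P ρ₁ ρ₂) hx
  simp only [hs, implies_true, true_and]
  unfold IsPNormalised normaliser
  rcases hρ with rfl | rfl
  · simp [← Matrix.ext_iff, hA.matCoef_apply, Matrix.one_apply]
    tauto
  · rcases hP with rfl | rfl
    · simp [← Matrix.ext_iff, hA.matCoef_apply, J₂_ne_one.symm]
      tauto
    · simp only [J₂_inv]
      simp [← Matrix.ext_iff, hA.matCoef_apply, J₂, Matrix.mul_apply, Matrix.vecHead,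
        Matrix.vecTail]
      tauto

/-- The function whose canonical factorisations are the stable `P`-normalised factorisations. -/
def reduced (P : Matrix (Fin 2) (Fin 2) ℂ) (ρ₁ ρ₂ : ℤ) (a : WienerMat) : WienerMat :=
  diag (-ρ₁) (-ρ₂) * normaliser P ρ₁ ρ₂ * a

/-- A stable `P`-normalised factorisation yields a canonical one. -/
lemma exists_isCanonical {P : Matrix (Fin 2) (Fin 2) ℂ} (hP : P = 1 ∨ P = J₂) {ρ₁ ρ₂ : ℤ}
    {A Am Ap : MatFun} {a : WienerMat} (ha : Represents a A)
    (h : IsStablePFactorisation P A ρ₁ ρ₂ Am Ap) :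
    ∃ y y' x x', IsCanonical projPlus (reduced P ρ₁ ρ₂ a) y y' x x' ∧
      Represents x' (matInv Ap) ∧
      Represents (diag ρ₁ ρ₂ * y' * diag (-ρ₁) (-ρ₂) * normaliser P ρ₁ ρ₂) (matInv Am) := by
  have hρ : ρ₁ = ρ₂ ∨ ρ₂ = ρ₁ + 1 := by have := h.fact.le; have := h.stable; omega
  set D := diag ρ₁ ρ₂ with hD
  set E := diag (-ρ₁) (-ρ₂) with hE
  have hDE : D * E = 1 := diag_mul_diag_neg _ _
  have hED : E * D = 1 := diag_neg_mul_diag _ _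
  set Q := normaliser P ρ₁ ρ₂ with hQ
  have hQQ : Q * Q = 1 := normaliser_mul_self _ _ _
  obtain ⟨m, hm⟩ := exists_represents h.fact.minus.1.1
  obtain ⟨m', hm'⟩ := exists_represents h.fact.minus.2.2.1
  obtain ⟨x, hx⟩ := exists_represents h.fact.plus.1.1
  obtain ⟨x', hx'⟩ := exists_represents h.fact.plus.2.2.1
  have hmm := hm.mul_eq_one hm' h.fact.minus.2.1
  have hxx := hx.mul_eq_one hx' h.fact.plus.2.1
  have hQm : Q * m * (m' * Q) = 1 := by
    rw [mul_assoc, ← mul_assoc m, hmm, one_mul, hQQ]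
  have hnorm := (isPNormalised_iff hP hρ hm (hm.suppLE h.fact.minus.1)).1 h.normalised
  have ham : a = m * D * x := ext_ev fun t => by
    rw [map_mul, map_mul, ← hm t, ← hx t, ← represents_diag ρ₁ ρ₂ t, ← ha t,
      h.fact.eq t t.norm_coe]
  have hsupp : ∀ i j, SuppLE 0 ((m' * Q) i j) := by
    simpa using suppLE_mul (hm'.suppLE h.fact.minus.2.2) (normaliser_supp P ρ₁ ρ₂)
  refine ⟨conj ρ₁ ρ₂ (Q * m), conj ρ₁ ρ₂ (m' * Q), x, x', ⟨?_, ?_, ?_, hxx, mul_eq_one_comm.1 hxx,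
    hnorm, projPlus_conj_inv_sub_one_eq_zero hρ hnorm hsupp hQm,
    projPlus_eq_self_iff.2 (hx.suppGE h.fact.plus.1),
    projPlus_eq_self_iff.2 (hx'.suppGE h.fact.plus.2.2)⟩, hx', ?_⟩
  · rw [reduced, conj, ham]
    simp only [mul_assoc, hD, hQ]
  · rw [conj_mul, hQm, conj_one]
  · rw [conj_mul, mul_eq_one_comm.1 hQm, conj_one]
  · have : D * conj ρ₁ ρ₂ (m' * Q) * E * Q = (D * E) * m' * (Q * (D * E) * Q) := by
      simp only [conj, mul_assoc, hE, hD]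
    rw [this, hDE, mul_one, hQQ, one_mul, mul_one]
    exact hm'

/-- A canonical factorisation yields a stable `P`-normalised one. -/
lemma exists_isStablePFactorisation {P : Matrix (Fin 2) (Fin 2) ℂ} (hP : P = 1 ∨ P = J₂)
    {ρ₁ ρ₂ : ℤ} (hρ : ρ₁ = ρ₂ ∨ ρ₂ = ρ₁ + 1) {A : MatFun} {a y y' x x' : WienerMat}
    (ha : Represents a A) (h : IsCanonical projPlus (reduced P ρ₁ ρ₂ a) y y' x x') :
    ∃ Am Ap, IsStablePFactorisation P A ρ₁ ρ₂ Am Ap := by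
  set D := diag ρ₁ ρ₂ with hD
  set E := diag (-ρ₁) (-ρ₂) with hE
  have hDE : D * E = 1 := diag_mul_diag_neg _ _
  have hED : E * D = 1 := diag_neg_mul_diag _ _
  set Q := normaliser P ρ₁ ρ₂ with hQ
  have hQQ : Q * Q = 1 := normaliser_mul_self _ _ _
  have hconj : ∀ z, conj ρ₁ ρ₂ (D * z * E) = z := fun z => by
    have : conj ρ₁ ρ₂ (D * z * E) = (E * D) * z * (E * D) := by
      simp only [conj, mul_assoc, hE, hD]
    rw [this, hED, one_mul, mul_one]
  have hy : projPlus (conj ρ₁ ρ₂ (D * y * E) - 1) = 0 := by rw [hconj]; exact h.y_minus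
  have hy' : projPlus (conj ρ₁ ρ₂ (D * y' * E) - 1) = 0 := by rw [hconj]; exact h.y'_minus
  have hs := ((projPlus_conj_sub_one_eq_zero_iff hρ _).1 hy).1
  have hs' := ((projPlus_conj_sub_one_eq_zero_iff hρ _).1 hy').1
  set m := Q * (D * y * E) with hm
  set m' := D * y' * E * Q with hm'
  have hmm : m * m' = 1 := by
    have : m * m' = Q * (D * (y * (E * D) * y') * E) * Q := by
      simp only [hm, hm', mul_assoc]
    rw [this, hED, mul_one, h.y_mul, mul_one, hDE, mul_one, hQQ]
  have hsm : ∀ i j, SuppLE 0 (m i j) := by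
    simpa using suppLE_mul (normaliser_supp P ρ₁ ρ₂) hs
  have hsm' : ∀ i j, SuppLE 0 (m' i j) := by
    simpa using suppLE_mul hs' (normaliser_supp P ρ₁ ρ₂)
  have hrm := represents_toMatFun m
  have hrx := represents_toMatFun x
  refine ⟨toMatFun m, toMatFun x, ⟨⟨hrm.memWienerMinus hsm, hrm.isUnit hmm,
    (hrm.matInv hmm).memWienerMinus hsm'⟩, ⟨hrx.memWienerPlus (projPlus_eq_self_iff.1 h.x_plus),
    hrx.isUnit h.x_mul, (hrx.matInv h.x_mul).memWienerPlus (projPlus_eq_self_iff.1 h.x'_plus)⟩,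
    by omega, fun t ht => ?_⟩, by omega, ?_⟩
  · have ham : a = m * D * x := by
      have h1 : m * D * x = Q * (D * (y * (E * D) * x)) := by simp only [hm, mul_assoc]
      have h2 : D * (E * Q * a) = (D * E) * (Q * a) := by simp only [mul_assoc]
      rw [h1, hED, mul_one, ← h.eq, reduced, h2, hDE, one_mul, ← mul_assoc, hQQ, one_mul]
    obtain ⟨s, rfl⟩ : ∃ s : Circle, (s : ℂ) = t := ⟨⟨t, mem_sphere_zero_iff_norm.2 ht⟩, rfl⟩
    rw [ha s, ham, map_mul, map_mul, ← hrm s, ← hrx s, ← represents_diag ρ₁ ρ₂ s]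
  · rw [isPNormalised_iff hP hρ hrm hsm]
    have : Q * m = D * y * E := by rw [hm, ← mul_assoc, hQQ, one_mul]
    rw [← hQ, this, hy]

/-- Stability of `P`-normalised factorisations: matrix functions close to `A` in the Wiener algebra
have a stable `P`-normalised factorisation with the same partial indices, and the norms of the
inverses of the factors are bounded. -/
theorem exists_isStablePFactorisation_of_norm_sub_lt {P : Matrix (Fin 2) (Fin 2) ℂ}
    (hP : P = 1 ∨ P = J₂) {ρ₁ ρ₂ : ℤ} {A Am Ap : MatFun} {a : WienerMat} (ha : Represents a A)
    (h : IsStablePFactorisation P A ρ₁ ρ₂ Am Ap) :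
    ∃ ε > 0, ∃ C, ∀ (B : MatFun) (b : WienerMat), Represents b B → ‖b - a‖ < ε →
      (∃ Bm Bp, IsStablePFactorisation P B ρ₁ ρ₂ Bm Bp) ∧
      ∀ Bm Bp, IsStablePFactorisation P B ρ₁ ρ₂ Bm Bp →
        wienerNorm (matInv Bp) ≤ C ∧ wienerNorm (matInv Bm) ≤ C := by
  have hρ : ρ₁ = ρ₂ ∨ ρ₂ = ρ₁ + 1 := by have := h.fact.le; have := h.stable; omega
  obtain ⟨y, y', x, x', hc, -, -⟩ := exists_isCanonical hP ha h
  obtain ⟨ε, hε, C, hC⟩ := hc.exists_of_norm_sub_lt isSplitting_projPlus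
  set S := diag (-ρ₁) (-ρ₂) * normaliser P ρ₁ ρ₂ with hS
  -- Passing to `reduced` multiplies differences by `S`. The second bound belongs to the inverse
  -- minus factor `diag ρ₁ ρ₂ * y' * S`.
  refine ⟨ε / (‖S‖ + 1), by positivity,
    max (4 * C) (4 * (‖diag ρ₁ ρ₂‖ * C * ‖S‖)), fun B b hb hba => ?_⟩
  obtain ⟨z, z', w, w', hzw, hz', hw'⟩ := hC (reduced P ρ₁ ρ₂ b) (by
    rw [reduced, reduced, ← mul_sub]
    rw [lt_div_iff₀ (by positivity)] at hba
    calc ‖S * (b - a)‖ ≤ ‖S‖ * ‖b - a‖ := norm_mul_le _ _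
      _ ≤ ‖b - a‖ * (‖S‖ + 1) := by nlinarith [norm_nonneg (b - a)]
      _ < ε := hba)
  refine ⟨exists_isStablePFactorisation hP hρ hb hzw, fun Bm Bp hB => ?_⟩
  obtain ⟨u, u', v, v', huv, hv', hu'⟩ := exists_isCanonical hP hb hB
  -- Uniqueness transfers the bounds to the arbitrary factorisation `Bm`, `Bp`.
  obtain ⟨h1, h2⟩ := hzw.inv_unique isSplitting_projPlus huv
  subst h1 h2
  refine ⟨le_max_of_le_left (hv'.wienerNorm_le.trans (by gcongr)),
    le_max_of_le_right (hu'.wienerNorm_le.trans ?_)⟩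
  rw [mul_assoc _ _ (normaliser P ρ₁ ρ₂)]
  gcongr
  refine (norm_mul_le _ _).trans ?_
  gcongr
  refine (norm_mul_le _ _).trans ?_
  gcongr

end WienerMat

/-! ### Analytic functions as elements of the Wiener algebra, and their truncations. -/

/-- The Cauchy power series has radius of convergence at least `R > 1`, hence converges absolutely
at radius 1. The value of `c 0` serves to exclude a constant term in the minus case. -/
lemma exists_powerSeries {f : ℂ → ℂ} {R : ℝ} (hR : 1 < R)
    (hf : DifferentiableOn ℂ f (Metric.closedBall 0 R)) :
    ∃ c : ℕ → ℂ, (Summable fun n => ‖c n‖) ∧ (∀ t : ℂ, ‖t‖ = 1 → HasSum (fun n => c n * t ^ n) (f t))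
      ∧ c 0 = f 0 := by
  lift R to NNReal using (zero_lt_one.trans hR).le
  have hR' : 1 < R := by exact_mod_cast hR
  have h := hf.hasFPowerSeriesOnBall (zero_lt_one.trans hR')
  set p := cauchyPowerSeries f 0 R
  refine ⟨p.coeff, ?_, fun t ht => ?_, ?_⟩
  · have h1 : ((1 : NNReal) : ℝ≥0∞) < p.radius :=
      (ENNReal.coe_lt_coe.2 hR').trans_le h.r_le
    simpa using p.summable_norm_mul_pow h1
  · have h1 := h.hasSum (y := t) (by
      rw [Metric.mem_eball, edist_zero_right, enorm_eq_nnnorm, ENNReal.coe_lt_coe,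
        ← NNReal.coe_lt_coe, coe_nnnorm, ht]
      exact hR)
    rw [zero_add] at h1
    refine h1.congr_fun fun n => ?_
    simp [mul_comm]
  · exact h.coeff_zero _

namespace WienerSeq

lemma norm_monomial (k : ℤ) : ‖monomial k‖ = 1 := by
  refine (hasSum_norm _).unique ?_
  refine (hasSum_ite_eq k (1 : ℝ)).congr_fun fun n => ?_
  rw [monomial_apply]
  split_ifs <;> simp

/-- The exponents `j` are free so that power series in `t` and in `t⁻¹` are treated alike. -/
lemma exists_of_summable {c : ℕ → ℂ} (hc : Summable fun n => ‖c n‖) (j : ℕ → ℤ) :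
    ∃ x : WienerSeq, (∀ t : Circle, HasSum (fun n => c n * (t : ℂ) ^ j n) (ev t x)) ∧
      ∀ k, (∀ n, j n = k → c n = 0) → x k = 0 := by
  have hs : HasSum (fun n => c n • monomial (j n)) (∑' n, c n • monomial (j n)) :=
    (Summable.of_norm (by simpa [norm_smul, norm_monomial] using hc)).hasSum
  refine ⟨_, fun t => by simpa using hs.mapL (ev t), fun k hk => ?_⟩
  refine (hs.mapL (coef k)).unique (hasSum_zero.congr_fun fun n => ?_)
  rw [map_smul, coef_apply, monomial_apply]
  split_ifs with h
  · simp [hk n h.symm]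
  · simp

lemma sum_ev (x : WienerSeq) (s : Finset ℤ) (t : Circle) :
    ev t (∑ k ∈ s, x k • monomial k) = ∑ k ∈ s, x k * (t : ℂ) ^ k := by
  simp [map_sum]

lemma tendsto_sum_Icc (x : WienerSeq) :
    Tendsto (fun N : ℕ => ∑ k ∈ Finset.Icc (-N : ℤ) N, x k • monomial k) atTop (𝓝 x) :=
  (hasSum_monomial x).comp Finset.tendsto_Icc_neg

lemma SuppGE.tendsto_sum {x : WienerSeq} (hx : SuppGE 0 x) :
    Tendsto (fun N : ℕ => ∑ k ∈ Finset.Icc (0 : ℤ) N, x k • monomial k) atTop (𝓝 x) := by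
  refine (tendsto_sum_Icc x).congr fun N => ?_
  refine (Finset.sum_subset (Finset.Icc_subset_Icc (by omega) le_rfl) fun k hk hk' => ?_).symm
  rw [Finset.mem_Icc] at hk hk'
  rw [hx k (by omega), zero_smul]

lemma SuppLE.tendsto_sum {x : WienerSeq} (hx : SuppLE (-1) x) :
    Tendsto (fun N : ℕ => ∑ k ∈ Finset.Icc (-N : ℤ) (-1), x k • monomial k) atTop (𝓝 x) := by
  refine (tendsto_sum_Icc x).congr fun N => ?_
  refine (Finset.sum_subset (Finset.Icc_subset_Icc le_rfl (by omega)) fun k hk hk' => ?_).symm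
  rw [Finset.mem_Icc] at hk hk'
  rw [hx k (by omega), zero_smul]

end WienerSeq

/-- A function analytic in a disc of radius greater than one is in the plus Wiener algebra. -/
lemma exists_suppGE {r₂ : ℝ≥0∞} (hr₂ : 1 < r₂) {α : ℂ → ℂ}
    (hα : DifferentiableOn ℂ α {z | ENNReal.ofReal ‖z‖ < r₂}) :
    ∃ x : WienerSeq, SuppGE 0 x ∧ ∀ t : Circle, α t = ev t x := by
  obtain ⟨R, hR1, hR2⟩ := ENNReal.lt_iff_exists_nnreal_btwn.1 hr₂
  have hR : (1 : ℝ) < R := by exact_mod_cast hR1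
  obtain ⟨c, hc, hsum, -⟩ := exists_powerSeries hR (hα.mono fun z hz => by
    refine lt_of_le_of_lt ?_ hR2
    rw [← ENNReal.ofReal_coe_nnreal]
    exact ENNReal.ofReal_le_ofReal (by simpa using hz))
  obtain ⟨x, hx, hx0⟩ := WienerSeq.exists_of_summable hc (fun n => n)
  refine ⟨x, fun k hk => hx0 k fun n hn => by omega, fun t => ?_⟩
  exact (hsum t t.norm_coe).unique (by simpa using hx t)

/-- A function analytic outside of a disc of radius less than one, and vanishing at infinity, is in
the minus Wiener algebra. -/
lemma exists_suppLE {r₁ : ℝ} (hr₁ : 0 ≤ r₁) (hr₁' : r₁ < 1) {β : ℂ → ℂ}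
    (hβ : DifferentiableOn ℂ β {z | r₁ < ‖z‖})
    (hβ_inf : Tendsto β (Bornology.cobounded ℂ) (𝓝 0)) :
    ∃ x : WienerSeq, SuppLE (-1) x ∧ ∀ t : Circle, β t = ev t x := by
  obtain ⟨s, hs1, hs2⟩ := exists_between hr₁'
  have hs0 : 0 < s := hr₁.trans_lt hs1
  have hR : 1 < s⁻¹ := (one_lt_inv₀ hs0).2 hs2
  -- Inversion moves infinity to 0, where the singularity is removable because `β` tends to 0 there.
  set g : ℂ → ℂ := Function.update (fun w => β w⁻¹) 0 0 with hg
  have hg' : ∀ w, w ≠ 0 → g w = β w⁻¹ := fun w hw => Function.update_of_ne hw _ _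
  have hd : DifferentiableOn ℂ g (Metric.closedBall 0 s⁻¹) := by
    rw [← Complex.differentiableOn_compl_singleton_and_continuousAt_iff
      (Metric.closedBall_mem_nhds 0 (inv_pos.2 hs0))]
    constructor
    · have : DifferentiableOn ℂ (fun w => β w⁻¹) (Metric.closedBall 0 s⁻¹ \ {0}) := by
        refine hβ.comp (differentiableOn_inv.mono fun w hw => hw.2) fun w hw => ?_
        have hw0 : 0 < ‖w‖ := norm_pos_iff.2 hw.2
        have hw1 : ‖w‖ ≤ s⁻¹ := by simpa using hw.1
        simp only [Set.mem_ofPred_eq, norm_inv]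
        exact hs1.trans_le ((le_inv_comm₀ hs0 hw0).2 hw1)
      exact this.congr fun w hw => hg' w hw.2
    · rw [hg, continuousAt_update_same]
      exact hβ_inf.comp tendsto_inv₀_nhdsNE_zero
  obtain ⟨c, hc, hsum, hc0⟩ := exists_powerSeries hR hd
  obtain ⟨x, hx, hx0⟩ := WienerSeq.exists_of_summable hc (fun n => -(n : ℤ))
  refine ⟨x, fun k hk => hx0 k fun n hn => ?_, fun t => ?_⟩
  · obtain rfl : n = 0 := by omega
    rw [hc0, hg, Function.update_self]
  · have h1 := hsum (t : ℂ)⁻¹ (by rw [norm_inv, t.norm_coe, inv_one])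
    rw [hg' _ (inv_ne_zero t.coe_ne_zero), inv_inv] at h1
    exact h1.unique (by simpa using hx t)

/-! ### Convergence of the truncated reduced forms. -/

namespace WienerMat

/-- The Fourier series of the reduced form. -/
def reducedForm (θ : ℤ) (x y : WienerSeq) : WienerMat := !![1, y; x, monomial θ + x * y]

lemma represents_reducedForm {θ : ℤ} {α β : ℂ → ℂ} {x y : WienerSeq}
    (hα : ∀ t : Circle, α t = WienerSeq.ev t x) (hβ : ∀ t : Circle, β t = WienerSeq.ev t y) :
    Represents (reducedForm θ x y) (WienerHopf.reducedForm θ α β) := fun t => by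
  ext i j
  fin_cases i <;> fin_cases j <;> simp [reducedForm, WienerHopf.reducedForm, hα, hβ]

lemma tendsto_norm_reducedForm_sub {θ : ℤ} {u v : ℕ → WienerSeq} {x y : WienerSeq}
    (hu : Tendsto u atTop (𝓝 x)) (hv : Tendsto v atTop (𝓝 y)) :
    Tendsto (fun N => ‖reducedForm θ (u N) (v N) - reducedForm θ x y‖) atTop (𝓝 0) := by
  have h1 := tendsto_iff_norm_sub_tendsto_zero.1 hu
  have h2 := tendsto_iff_norm_sub_tendsto_zero.1 hv
  have h3 := tendsto_iff_norm_sub_tendsto_zero.1 (hu.mul hv)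
  have h4 := (h2.add h1).add h3
  simp only [add_zero] at h4
  refine squeeze_zero (fun _ => norm_nonneg _) (fun N => (norm_le_sum _).trans_eq ?_) h4
  simp [reducedForm, Fin.sum_univ_two]
  ring

end WienerMat

lemma represents_reducedTrunc {θ : ℤ} {α β : ℂ → ℂ} {x y : WienerSeq}
    (hα : ∀ t : Circle, α t = ev t x) (hβ : ∀ t : Circle, β t = ev t y) (N : ℕ) :
    WienerMat.Represents (WienerMat.reducedForm θ (∑ k ∈ Finset.Icc (0 : ℤ) N, x k • monomial k)
      (∑ k ∈ Finset.Icc (-N : ℤ) (-1), y k • monomial k)) (reducedTrunc θ α β N) := by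
  refine WienerMat.represents_reducedForm (fun t => ?_) fun t => ?_
  · rw [sum_ev, truncPlus]
    simp only [fourierCoef_ev hα]
  · rw [sum_ev, truncMinus]
    simp only [fourierCoef_ev hβ]

/-! ### Uniform decay of `δ_N` on compact sets of admissible pairs. -/

lemma maxCircle_nonneg (f : ℂ → ℂ) (ζ : ℝ) : 0 ≤ maxCircle f ζ :=
  Real.sSup_nonneg (by rintro _ ⟨t, -, rfl⟩; exact norm_nonneg _)

lemma maxCircle_le {f : ℂ → ℂ} {ζ C : ℝ} (hC : 0 ≤ C) (h : ∀ t : ℂ, ‖t‖ = ζ → ‖f t‖ ≤ C) :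
    maxCircle f ζ ≤ C :=
  Real.sSup_le (by rintro _ ⟨t, ht, rfl⟩; exact h t (by simpa using ht)) hC

lemma delta_nonneg (α β : ℂ → ℂ) (N : ℕ) {ζ₁ ζ₂ : ℝ} (h0 : 0 ≤ ζ₁) (h1 : ζ₁ < 1) (h2 : 1 < ζ₂) :
    0 ≤ delta α β N ζ₁ ζ₂ := by
  have hα := maxCircle_nonneg α ζ₂
  have hβ := maxCircle_nonneg β ζ₁
  have h3 := sub_pos.2 h1
  have h4 := sub_pos.2 h2
  have h5 : 0 < ζ₂ := by linarith
  unfold delta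
  positivity

/-- Each factor is replaced by its worst value. Both a lower bound `s` and an upper bound `S` are
needed, as `ζ₂` occurs in denominators and in a numerator. -/
lemma delta_le {α β : ℂ → ℂ} (N : ℕ) {ζ₁ ζ₂ m s S A B : ℝ} (h0 : 0 ≤ ζ₁) (h1 : ζ₁ ≤ m)
    (hm : m < 1) (hs : 1 < s) (h2 : s ≤ ζ₂) (hS : ζ₂ ≤ S) (hA : maxCircle α ζ₂ ≤ A)
    (hB : maxCircle β ζ₁ ≤ B) :
    delta α β N ζ₁ ζ₂ ≤ (1 + S * A / (s - 1)) * (m ^ (N + 1) * B / (1 - m)) +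
      (1 + m * B / (1 - m)) * (A / (s ^ N * (s - 1))) := by
  have hα := maxCircle_nonneg α ζ₂
  have hβ := maxCircle_nonneg β ζ₁
  have h3 := sub_pos.2 hm
  have h4 := sub_pos.2 hs
  have h5 : 0 < ζ₂ := by linarith
  have h6 : 0 < S := by linarith
  have h7 : 0 ≤ A := hα.trans hA
  have h8 : 0 ≤ B := hβ.trans hB
  have h9 : 0 ≤ m := h0.trans h1
  have h10 : 0 < s := by linarith
  have h11 : 0 < ζ₂ - 1 := by linarith
  have h12 : 0 < 1 - ζ₁ := by linarith
  unfold delta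
  gcongr

/-- Uniform bounds for the data of the truncation error on a compact set of admissible pairs. -/
lemma exists_bounds {r₁ : ℝ} {r₂ : ℝ≥0∞} (hr₁ : 0 ≤ r₁) {α β : ℂ → ℂ}
    (hα : DifferentiableOn ℂ α {z | ENNReal.ofReal ‖z‖ < r₂})
    (hβ : DifferentiableOn ℂ β {z | r₁ < ‖z‖}) {K : Set (ℝ × ℝ)} (hK : IsCompact K)
    (hne : K.Nonempty) (hKa : K ⊆ admissible r₁ r₂ α β) :
    ∃ m s S A B : ℝ, m < 1 ∧ 1 < s ∧ ∀ ζ ∈ K, 0 ≤ ζ.1 ∧ ζ.1 ≤ m ∧ s ≤ ζ.2 ∧ ζ.2 ≤ S ∧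
      maxCircle α ζ.2 ≤ A ∧ maxCircle β ζ.1 ≤ B := by
  obtain ⟨a, haK, ha⟩ := hK.exists_isMinOn hne continuous_fst.continuousOn
  obtain ⟨b, hbK, hb⟩ := hK.exists_isMaxOn hne continuous_fst.continuousOn
  obtain ⟨c, hcK, hc⟩ := hK.exists_isMinOn hne continuous_snd.continuousOn
  obtain ⟨d, hdK, hd⟩ := hK.exists_isMaxOn hne continuous_snd.continuousOn
  -- The extreme radii in `K` are attained by admissible pairs, so either they lie strictly inside
  -- the domain of analyticity or continuity up to the boundary circle is available. Hence `α` and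
  -- `β` are bounded on a closed disc and a closed annulus covering all circles in question.
  have hαc : ContinuousOn α (Metric.closedBall 0 d.2) := by
    rcases (hKa hdK).2.2 with h | ⟨h, h'⟩
    · exact hα.continuousOn.mono fun z hz =>
        (ENNReal.ofReal_le_ofReal (by simpa using hz)).trans_lt h
    · exact h'.mono fun z hz => (ENNReal.ofReal_le_ofReal (by simpa using hz)).trans_eq h
  have hβc : ContinuousOn β (Metric.closedBall 0 1 ∩ {z | a.1 ≤ ‖z‖}) := by
    rcases (hKa haK).1.2 with h | ⟨h, -, h'⟩
    · exact hβ.continuousOn.mono fun z hz => h.trans_le hz.2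
    · exact h'.mono fun z hz => h.symm.trans_le hz.2
  obtain ⟨A, hA⟩ := (isCompact_closedBall (0 : ℂ) d.2).exists_bound_of_continuousOn hαc
  obtain ⟨B, hB⟩ := ((isCompact_closedBall (0 : ℂ) 1).inter_right
    (isClosed_le continuous_const continuous_norm)).exists_bound_of_continuousOn hβc
  refine ⟨b.1, c.2, d.2, max A 0, max B 0, (hKa hbK).1.1, (hKa hcK).2.1, fun ζ hζ =>
    ⟨?_, hb hζ, hc hζ, hd hζ, ?_, ?_⟩⟩
  · rcases (hKa hζ).1.2 with h | ⟨h, h', -⟩ <;> linarith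
  · refine maxCircle_le (le_max_right _ _) fun t ht => le_max_of_le_left (hA t ?_)
    rw [mem_closedBall_zero_iff, ht]
    exact hd hζ
  · refine maxCircle_le (le_max_right _ _) fun t ht => le_max_of_le_left (hB t ⟨?_, ?_⟩)
    · rw [mem_closedBall_zero_iff, ht]
      exact (hKa hζ).1.1.le
    · rw [Set.mem_ofPred_eq, ht]
      exact ha hζ

/-- The truncation error tends to zero, uniformly on compact sets of admissible pairs. -/
lemma eventually_delta_lt {r₁ : ℝ} {r₂ : ℝ≥0∞} (hr₁ : 0 ≤ r₁) {α β : ℂ → ℂ}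
    (hα : DifferentiableOn ℂ α {z | ENNReal.ofReal ‖z‖ < r₂})
    (hβ : DifferentiableOn ℂ β {z | r₁ < ‖z‖}) {K : Set (ℝ × ℝ)} (hK : IsCompact K)
    (hKa : K ⊆ admissible r₁ r₂ α β) {ε : ℝ} (hε : 0 < ε) :
    ∀ᶠ N : ℕ in atTop, ∀ ζ ∈ K, 0 ≤ delta α β N ζ.1 ζ.2 ∧ delta α β N ζ.1 ζ.2 < ε := by
  rcases K.eq_empty_or_nonempty with rfl | hne
  · simp
  obtain ⟨m, s, S, A, B, hm, hs, h⟩ := exists_bounds hr₁ hα hβ hK hne hKa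
  have hm0 : 0 ≤ m := by
    obtain ⟨ζ, hζ⟩ := hne
    exact (h ζ hζ).1.trans (h ζ hζ).2.1
  have h1 : Tendsto (fun N : ℕ => m ^ (N + 1)) atTop (𝓝 0) :=
    (tendsto_pow_atTop_nhds_zero_of_lt_one hm0 hm).comp (tendsto_add_atTop_nat 1)
  have h2 : Tendsto (fun N : ℕ => (s ^ N)⁻¹) atTop (𝓝 0) :=
    (tendsto_pow_atTop_atTop_of_one_lt hs).inv_tendsto_atTop
  have h3 : Tendsto (fun N : ℕ => (1 + S * A / (s - 1)) * (m ^ (N + 1) * B / (1 - m)) +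
      (1 + m * B / (1 - m)) * (A / (s ^ N * (s - 1)))) atTop (𝓝 0) := by
    have h4 := (((h1.mul_const B).div_const (1 - m)).const_mul (1 + S * A / (s - 1))).add
      ((h2.const_mul (A / (s - 1))).const_mul (1 + m * B / (1 - m)))
    simp only [zero_mul, zero_div, mul_zero, add_zero] at h4
    refine h4.congr fun N => ?_
    rw [← div_eq_mul_inv, div_div, mul_comm (s - 1)]
  filter_upwards [h3.eventually_lt_const hε] with N hN ζ hζ
  obtain ⟨g0, g1, g2, g3, g4, g5⟩ := h ζ hζ
  exact ⟨delta_nonneg α β N g0 (g1.trans_lt hm) (hs.trans_le g2),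
    (delta_le N g0 g1 hm hs g2 g3 g4 g5).trans_lt hN⟩

lemma wienerNorm_nonneg (A : MatFun) : 0 ≤ wienerNorm A :=
  tsum_nonneg fun _ => WienerMat.colSumNorm_nonneg _

lemma sigma_nonneg (θ : ℤ) : 0 ≤ sigma θ := by
  unfold sigma; split_ifs <;> norm_num

end WienerHopf

end

theorem theorem4p1
    (r₁ : ℝ) (r₂ : ENNReal) (hr₁ : 0 ≤ r₁) (hr₁' : r₁ < 1) (hr₂ : 1 < r₂)
    (θ : ℤ) (α β : ℂ → ℂ)
    (hα : DifferentiableOn ℂ α {z | ENNReal.ofReal ‖z‖ < r₂})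
    (hβ : DifferentiableOn ℂ β {z | r₁ < ‖z‖})
    (hβ_inf : Filter.Tendsto β (Bornology.cobounded ℂ) (nhds 0))
    (P : Matrix (Fin 2) (Fin 2) ℂ) (hP : P = 1 ∨ P = WienerHopf.J₂)
    (ρ₁ ρ₂ : ℤ) (am ap : WienerHopf.MatFun)
    (ha : WienerHopf.IsStablePFactorisation P (WienerHopf.reducedForm θ α β) ρ₁ ρ₂ am ap) :
    ∃ N₀ : ℕ,
      (∀ N : ℕ, N₀ < N → ∃ amN apN : WienerHopf.MatFun,
        WienerHopf.IsStablePFactorisation P (WienerHopf.reducedTrunc θ α β N) ρ₁ ρ₂ amN apN) ∧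
      ∀ K : Set (ℝ × ℝ), IsCompact K → K ⊆ WienerHopf.admissible r₁ r₂ α β →
        ∃ N₁ : ℕ, N₀ ≤ N₁ ∧ ∀ N : ℕ, N₁ < N → ∀ amN apN : WienerHopf.MatFun,
          WienerHopf.IsStablePFactorisation P (WienerHopf.reducedTrunc θ α β N) ρ₁ ρ₂ amN apN →
          ∀ ζ ∈ K, WienerHopf.qValue θ α β N amN apN ζ.1 ζ.2 < 1 := by
  obtain ⟨x, hx, hαx⟩ := WienerHopf.exists_suppGE hr₂ hα
  obtain ⟨y, hy, hβy⟩ := WienerHopf.exists_suppLE hr₁ hr₁' hβ hβ_inf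
  -- Both constants depend on the factorised function alone, so `N₀` and the bound `C` serve every
  -- compact set `K`.
  obtain ⟨ε, hε, C, hC⟩ :=
    WienerHopf.WienerMat.exists_isStablePFactorisation_of_norm_sub_lt hP
      (WienerHopf.WienerMat.represents_reducedForm hαx hβy) ha
  have hlim := WienerHopf.WienerMat.tendsto_norm_reducedForm_sub (θ := θ) hx.tendsto_sum
    hy.tendsto_sum
  obtain ⟨N₀, hN₀⟩ := Filter.eventually_atTop.1 (hlim.eventually_lt_const hε)
  have hfac := fun N (hN : N₀ ≤ N) =>
    hC _ _ (WienerHopf.represents_reducedTrunc (θ := θ) hαx hβy N) (hN₀ N hN)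
  refine ⟨N₀, fun N hN => (hfac N hN.le).1, fun K hK hKa => ?_⟩
  have hσ := WienerHopf.sigma_nonneg θ
  -- Since `q_N ≤ σ δ C²`, it suffices that `δ * (σ * C² + 1) < 1`; the summand 1 keeps the
  -- denominator positive.
  obtain ⟨N₁, hN₁⟩ := Filter.eventually_atTop.1 (WienerHopf.eventually_delta_lt hr₁ hα hβ hK hKa
    (ε := 1 / (WienerHopf.sigma θ * C ^ 2 + 1)) (by positivity))
  refine ⟨max N₀ N₁, le_max_left _ _, fun N hN amN apN hfacN ζ hζ => ?_⟩
  obtain ⟨hp, hm⟩ := (hfac N ((le_max_left _ _).trans hN.le)).2 amN apN hfacN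
  obtain ⟨hδ0, hδ⟩ := hN₁ N ((le_max_right _ _).trans hN.le) ζ hζ
  rw [lt_div_iff₀ (by positivity)] at hδ
  have hp0 := WienerHopf.wienerNorm_nonneg (WienerHopf.matInv apN)
  have hm0 := WienerHopf.wienerNorm_nonneg (WienerHopf.matInv amN)
  have hC0 : 0 ≤ C := hp0.trans hp
  set δ := WienerHopf.delta α β N ζ.1 ζ.2 with hδ_def
  have hq : WienerHopf.qValue θ α β N amN apN ζ.1 ζ.2 ≤ WienerHopf.sigma θ * δ * C * C := by
    unfold WienerHopf.qValue
    gcongr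
  rcases hδ0.eq_or_lt with h0 | h0
  · rw [← h0] at hq
    linarith
  · nlinarith
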